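/- Let $n,k,i$ be integers with $1\le k\le n/2$ and $0\le i\le n-1$. Let $\Delta_{n,k}=\operatorname{conv}\{x\in\{0,1\}^n:\sum_j x_j=k\}$ be the $(n,k)$-hypersimplex, viewed as an $(n-1)$-dimensional polytope in $\mathbb{R}^n/\mathbb{R}(1,\dots,1)\cong\mathbb{R}^{n-1}$, and let $e_1,\dots,e_n$ be the images of the standard basis vectors in this quotient. A face $F$ of a polytope $P$ is strictly preserved under a linear map $\pi$ if $\pi(F)$ is a face of $\pi(P)$, $P\cap\pi^{-1}(\pi(F))=F$, and $\pi(F)$ is combinatorially isomorphic to $F$. A surjective linear map $\pi:\mathbb{R}^{n-1}\to\mathbb{R}^d$ is $i$-preserving for $\Delta_{n,k}$ if every face of $\Delta_{n,k}$ of dimension at most $i$ is strictly preserved under $\pi$. Let $S_\pi=(\pi(e_1),\dots,\pi(e_n))$, a configuration of $n$ labelled, possibly coinciding, points. A configuration $S$ is $j$-neighborly if every subset $A$ of at most $j$ of its (labelled) points is the vertex set of a face of $\operatorname{conv}(S)$ that contains no labelled point of $S$ outside $A$; it is $j$-almost neighborly if every subset of at most $j$ of its points lies in a common proper (possibly empty)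 face of $\operatorname{conv}(S)$ (so every configuration is $j$-almost neighborly for $j\le 0$). Then a surjective linear map $\pi:\mathbb{R}^{n-1}\to\mathbb{R}^d$ is $i$-preserving for $\Delta_{n,k}$ if and only if at least one of the following holds: (i) $S_\pi$ is $(k+i)$-neighborly; (ii) $S_\pi$ is $(n-2)$-dimensional and not $(k-i-1)$-almost neighborly; (iii) $\pi$ is an isomorphism. In particular, a surjective linear $i$-preserving map $\pi:\mathbb{R}^{n-1}\to\mathbb{R}^d$ for $\Delta_{n,k}$ exists if and only if $2k+2i\le d\le n-1$, or $d=n-2$ and $k\ge i+2$, or $d=n-1$. -/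

import Mathlib

/-- The `(n,k)`-hypersimplex `Δ_{n,k}`: the convex hull in `ℝⁿ` of the `0/1`-vectors with
coordinate sum `k`. -/
def hypersimplex (n k : ℕ) : Set (Fin n → ℝ) :=
  convexHull ℝ {x | (∀ j, x j = 0 ∨ x j = 1) ∧ ∑ j, x j = (k : ℝ)}

/-- The quotient `ℝⁿ / ℝ·(1,…,1)`, of dimension `n - 1`. -/
abbrev QuotSpace (n : ℕ) : Type :=
  (Fin n → ℝ) ⧸ Submodule.span ℝ {(fun _ => 1 : Fin n → ℝ)}

/-- The hypersimplex as a full-dimensional polytope in the quotient `ℝⁿ / ℝ·(1,…,1)`. -/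
def quotHypersimplex (n k : ℕ) : Set (QuotSpace n) :=
  Submodule.mkQ (Submodule.span ℝ {(fun _ => 1 : Fin n → ℝ)}) '' hypersimplex n k

/-- The labelled point configuration `S_π = (π(e_1), …, π(e_n))`. -/
def pointConfig {n d : ℕ} (π : QuotSpace n →ₗ[ℝ] (Fin d → ℝ)) : Fin n → (Fin d → ℝ) :=
  fun j => π (Submodule.mkQ (Submodule.span ℝ {(fun _ => 1 : Fin n → ℝ)}) (Pi.single j 1))

section Polytopes

variable {E E' : Type*} [AddCommGroup E] [Module ℝ E] [TopologicalSpace E]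
  [AddCommGroup E'] [Module ℝ E'] [TopologicalSpace E']

/-- `F` is a face of the polytope `P`: the set of maximizers of a linear functional, or `∅`
(`P` itself counts as a face, via the zero functional). -/
def IsFace (P F : Set E) : Prop := IsExposed ℝ P F

/-- Two polytopes are combinatorially isomorphic if their face lattices are isomorphic. -/
def CombIso (P : Set E) (Q : Set E') : Prop :=
  Nonempty ({F : Set E // IsFace P F} ≃o {G : Set E' // IsFace Q G})

/-- The face `F` of `P` is strictly preserved under `π : P → π(P)`. -/
def StrictlyPreserved (π : E →ₗ[ℝ] E') (P F : Set E) : Prop :=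
  IsFace (π '' P) (π '' F) ∧ P ∩ π ⁻¹' (π '' F) = F ∧ CombIso F (π '' F)

/-- `π` strictly preserves every face of `P` of dimension at most `i`. -/
def PreservesSkeleton (π : E →ₗ[ℝ] E') (P : Set E) (i : ℕ) : Prop :=
  ∀ F : Set E, IsFace P F → Module.finrank ℝ (vectorSpan ℝ F) ≤ i → StrictlyPreserved π P F

/-- The labelled configuration `p` is `j`-neighborly: every subconfiguration of at most `j`
points is the vertex set of a face of the convex hull (and no further point of the
configuration, counted with its label, lies on that face). -/
def IsNeighborly {ι : Type*} (p : ι → E) (j : ℕ) : Prop :=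
  ∀ A : Finset ι, A.card ≤ j → ∃ F : Set E, IsFace (convexHull ℝ (Set.range p)) F ∧
    F.extremePoints ℝ = p '' (A : Set ι) ∧ ∀ m, p m ∈ F → m ∈ A

/-- The labelled configuration `p` is `j`-almost neighborly: every subconfiguration of at most
`j` points lies in a common proper face (possibly empty) of the convex hull. -/
def IsAlmostNeighborly {ι : Type*} (p : ι → E) (j : ℤ) : Prop :=
  ∀ A : Finset ι, (A.card : ℤ) ≤ j → ∃ F : Set E, IsFace (convexHull ℝ (Set.range p)) F ∧
    F ≠ convexHull ℝ (Set.range p) ∧ ∀ m ∈ A, p m ∈ F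

end Polytopes

/-- `π : ℝⁿ / ℝ·(1,…,1) → ℝ^d` is `i`-preserving for `Δ_{n,k}`. -/
def IsIPreserving {n d : ℕ} (π : QuotSpace n →ₗ[ℝ] (Fin d → ℝ)) (k i : ℕ) : Prop :=
  PreservesSkeleton π (quotHypersimplex n k) i

/-! Everything is read off from the zero-sum linear dependences `v` among the labelled points
(`depSpace`), through the numbers of positive and negative coordinates of `v`.

If two points of the hypersimplex have the same image, their difference is such a dependence. A face
survives strictly as soon as none of its points shares its image with another point of the polytope
(`strictlyPreserved_of_fiber_trivial`). Conversely, a nonzero dependence with few signs of each kind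
gives a direction leaving a low-dimensional face inside the polytope and inside a fiber. Counting
coordinates equal to 0, equal to 1 and strictly between yields `isIPreserving_iff`: every nonzero
dependence has more than `k + i` negative or more than `n - k + i` positive coordinates.

Neighborliness and almost neighborliness have sign descriptions too. The configuration is
`m`-neighborly when every nonzero dependence has more than `m` negative coordinates
(`isNeighborly_iff`), and fails to be `m`-almost neighborly when some dependence has at least `n -
m` positive ones (`not_isAlmostNeighborly_iff`).

It remains to see which alternative occurs. If the dependences have dimension at least 2, removing 0
leaves a connected set, and since `2 * k ≤ n` the second alternative can never occur
(`lt_numNeg_of_two_le_finrank`). Dimension 1 gives either (i) or (ii), and dimension 0 means that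
the map is an isomorphism.

For existence, moment-curve dependences have many negative coordinates, a vector with `n - 1`
positive coordinates handles codimension one, and a dependence with many prescribed zeros gives the
bound on `d`. -/

/-! ### Faces of polytopes under linear maps. -/

section FacesUnderLinearMaps

section Algebraic

variable {E E' : Type*} [AddCommGroup E] [Module ℝ E] [AddCommGroup E'] [Module ℝ E']

/-- Convexity makes the cone of differences closed under addition: `t • (x - y) + t' • (x' - y')` is
`t + t'` times a difference of weighted means. -/
theorem Convex.exists_smul_sub_of_mem_vectorSpan {s : Set E} (hs : Convex ℝ s) (hne : s.Nonempty)
    {v : E} (hv : v ∈ vectorSpan ℝ s) :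
    ∃ t : ℝ, 0 ≤ t ∧ ∃ x ∈ s, ∃ y ∈ s, v = t • (x - y) := by
  obtain ⟨x₀, hx₀⟩ := hne
  refine Submodule.span_induction (p := fun v _ => ∃ t : ℝ, 0 ≤ t ∧ ∃ x ∈ s, ∃ y ∈ s,
    v = t • (x - y)) ?_ ?_ ?_ ?_ hv
  · rintro _ ⟨x, hx, y, hy, rfl⟩
    exact ⟨1, zero_le_one, x, hx, y, hy, by simp⟩
  · exact ⟨0, le_rfl, x₀, hx₀, x₀, hx₀, by simp⟩
  · rintro _ _ _ _ ⟨t, ht, x, hx, y, hy, rfl⟩ ⟨t', ht', x', hx', y', hy', rfl⟩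
    rcases eq_or_lt_of_le (add_nonneg ht ht') with h0 | h0
    · have h1 : t = 0 := by linarith
      have h2 : t' = 0 := by linarith
      exact ⟨0, le_rfl, x₀, hx₀, x₀, hx₀, by simp [h1, h2]⟩
    · have hc : t / (t + t') + t' / (t + t') = 1 := by field_simp
      refine ⟨t + t', h0.le, (t / (t + t')) • x + (t' / (t + t')) • x',
        hs hx hx' (by positivity) (by positivity) hc,
        (t / (t + t')) • y + (t' / (t + t')) • y',
        hs hy hy' (by positivity) (by positivity) hc, ?_⟩
      have e1 : (t + t') * (t / (t + t')) = t := by field_simp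
      have e2 : (t + t') * (t' / (t + t')) = t' := by field_simp
      simp only [smul_sub, smul_add, smul_smul, e1, e2]
      abel
  · rintro a _ _ ⟨t, ht, x, hx, y, hy, rfl⟩
    rcases le_total 0 a with ha | ha
    · exact ⟨a * t, mul_nonneg ha ht, x, hx, y, hy, by rw [smul_smul]⟩
    · refine ⟨-a * t, mul_nonneg (by linarith) ht, y, hy, x, hx, ?_⟩
      rw [smul_smul, ← neg_sub x y, smul_neg, neg_mul, neg_smul, neg_neg]

theorem Convex.exists_add_smul_sub_of_mem_affineSpan {s : Set E} (hs : Convex ℝ s)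
    {z : E} (hz : z ∈ affineSpan ℝ s) :
    ∃ t : ℝ, 0 ≤ t ∧ ∃ x ∈ s, ∃ y ∈ s, z = (1 + t) • x - t • y := by
  have hne : s.Nonempty := (affineSpan_nonempty ℝ).1 ⟨z, hz⟩
  obtain ⟨x₀, hx₀⟩ := hne
  have hv : z -ᵥ x₀ ∈ vectorSpan ℝ s :=
    vsub_mem_vectorSpan_of_mem_affineSpan_of_mem_affineSpan hz (mem_affineSpan ℝ hx₀)
  obtain ⟨t, ht, x, hx, y, hy, h⟩ := hs.exists_smul_sub_of_mem_vectorSpan ⟨x₀, hx₀⟩ hv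
  have hp : 0 < 1 + t := by linarith
  refine ⟨t, ht, (1 / (1 + t)) • x₀ + (t / (1 + t)) • x,
    hs hx₀ hx (by positivity) (by positivity) (by field_simp), y, hy, ?_⟩
  have e1 : (1 + t) * (1 / (1 + t)) = 1 := by field_simp
  have e2 : (1 + t) * (t / (1 + t)) = t := by field_simp
  rw [smul_add, smul_smul, smul_smul, e1, e2, one_smul, add_sub_assoc, ← smul_sub, ← h]
  simp

theorem Convex.eq_zero_of_mem_vectorSpan_of_injOn {s : Set E} (hs : Convex ℝ s)
    (π : E →ₗ[ℝ] E') (hπ : Set.InjOn π s) {v : E} (hv : v ∈ vectorSpan ℝ s) (h0 : π v = 0) :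
    v = 0 := by
  rcases s.eq_empty_or_nonempty with rfl | hne
  · simpa using hv
  obtain ⟨t, ht, x, hx, y, hy, rfl⟩ := hs.exists_smul_sub_of_mem_vectorSpan hne hv
  rw [map_smul, smul_eq_zero] at h0
  rcases h0 with h0 | h0
  · simp [h0]
  · rw [map_sub, sub_eq_zero] at h0
    rw [hπ hx hy h0, sub_self, smul_zero]

end Algebraic

variable {E E' : Type*} [AddCommGroup E] [Module ℝ E] [TopologicalSpace E] [IsTopologicalAddGroup E] [ContinuousSMul ℝ E] [T2Space E]
  [FiniteDimensional ℝ E]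
  [NormedAddCommGroup E'] [NormedSpace ℝ E'] [FiniteDimensional ℝ E']

/-- Functionals on the target pull back along `π`. In the other direction, injectivity on a convex
set gives injectivity on its direction space, so a linear left inverse there transports functionals
forward. -/
theorem isFace_image_iff_of_injOn {F : Set E} (hF : Convex ℝ F) (π : E →ₗ[ℝ] E')
    (hπ : Set.InjOn π F) {G : Set E} (hG : G ⊆ F) : IsFace (π '' F) (π '' G) ↔ IsFace F G := by
  constructor
  · rintro h hne
    obtain ⟨l, hl⟩ := h (hne.image π)
    refine ⟨l.comp (LinearMap.toContinuousLinearMap π), ?_⟩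
    ext x
    constructor
    · intro hx
      refine ⟨hG hx, fun y hy => ?_⟩
      have : π x ∈ π '' G := ⟨x, hx, rfl⟩
      rw [hl] at this
      exact this.2 _ ⟨y, hy, rfl⟩
    · rintro ⟨hx, h⟩
      have : π x ∈ π '' G := by
        rw [hl]
        refine ⟨⟨x, hx, rfl⟩, ?_⟩
        rintro _ ⟨y, hy, rfl⟩
        exact h y hy
      obtain ⟨y, hy, hyx⟩ := this
      rwa [← hπ (hG hy) hx hyx]
  · rintro h hne
    have hne' : G.Nonempty := Set.image_nonempty.1 hne
    obtain ⟨l, hl⟩ := h hne'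
    obtain ⟨g, hg⟩ := LinearMap.exists_leftInverse_of_injective
      (π ∘ₗ (vectorSpan ℝ F).subtype) (by
        rw [LinearMap.ker_eq_bot']
        rintro ⟨v, hv⟩ h0
        exact Subtype.ext (hF.eq_zero_of_mem_vectorSpan_of_injOn π hπ hv h0))
    let m : E' →ₗ[ℝ] ℝ := l.toLinearMap ∘ₗ (vectorSpan ℝ F).subtype ∘ₗ g
    -- The left inverse only controls directions of `F`, so values of `m` and `l` are compared
    -- through differences; this suffices for maximizers.
    have key : ∀ x ∈ F, ∀ y ∈ F, m (π x) - m (π y) = l x - l y := by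
      intro x hx y hy
      have h1 := LinearMap.congr_fun hg ⟨x - y, vsub_mem_vectorSpan ℝ hx hy⟩
      have h2 : g (π (x - y)) = ⟨x - y, vsub_mem_vectorSpan ℝ hx hy⟩ := h1
      rw [← map_sub, ← map_sub, ← map_sub]
      change l (g (π (x - y)) : E) = _
      rw [h2]
    refine ⟨LinearMap.toContinuousLinearMap m, ?_⟩
    ext z
    constructor
    · rintro ⟨x, hx, rfl⟩
      refine ⟨⟨x, hG hx, rfl⟩, ?_⟩
      rintro _ ⟨y, hy, rfl⟩
      rw [hl] at hx
      have := key x hx.1 y hy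
      have := hx.2 y hy
      simp only [LinearMap.coe_toContinuousLinearMap']
      linarith
    · rintro ⟨⟨x, hx, rfl⟩, h⟩
      refine ⟨x, ?_, rfl⟩
      rw [hl]
      refine ⟨hx, fun y hy => ?_⟩
      have h1 := h _ ⟨y, hy, rfl⟩
      have := key x hx y hy
      simp only [LinearMap.coe_toContinuousLinearMap'] at h1
      linarith

theorem combIso_image_of_injOn {F : Set E} (hF : Convex ℝ F) (π : E →ₗ[ℝ] E')
    (hπ : Set.InjOn π F) : CombIso F (π '' F) := by
  have hsub : ∀ G : {G : Set E // IsFace F G}, G.1 ⊆ F := fun G => IsExposed.subset G.2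
  refine ⟨⟨⟨fun G => ⟨π '' G.1, (isFace_image_iff_of_injOn hF π hπ (hsub G)).2 G.2⟩,
    fun H => ⟨F ∩ π ⁻¹' H.1, ?_⟩, ?_, ?_⟩, ?_⟩⟩
  · rw [← isFace_image_iff_of_injOn hF π hπ Set.inter_subset_left, Set.image_inter_preimage,
      Set.inter_eq_right.2 (IsExposed.subset H.2)]
    exact H.2
  · intro G
    refine Subtype.ext ?_
    exact hπ.preimage_image_inter (hsub G) ▸ Set.inter_comm _ _
  · intro H
    refine Subtype.ext ?_
    simp only [Set.image_inter_preimage]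
    exact Set.inter_eq_right.2 (IsExposed.subset H.2)
  · intro G G'
    exact hπ.image_subset_image_iff (hsub G) (hsub G')

/-- The hull of the generators outside `F` has an image disjoint from the affine span of `π '' F`. A
functional separating the two is constant on that span and exposes exactly `π '' F`. -/
theorem isFace_image_of_fiber_trivial {V : Set E} (hV : V.Finite) {F : Set E}
    (hF : IsFace (convexHull ℝ V) F) (π : E →ₗ[ℝ] E')
    (h : ∀ x ∈ F, ∀ y ∈ convexHull ℝ V, π x = π y → x = y) :
    IsFace (π '' convexHull ℝ V) (π '' F) := by
  intro hne
  have hFne : F.Nonempty := Set.image_nonempty.1 hne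
  have hFP : F ⊆ convexHull ℝ V := IsExposed.subset hF
  have hFc : Convex ℝ F := IsExposed.convex hF (convex_convexHull ℝ V)
  have hFext : IsExtreme ℝ (convexHull ℝ V) F := IsExposed.isExtreme hF
  obtain ⟨l, hl⟩ := hF hFne
  obtain ⟨x₀, hx₀⟩ := hFne
  have hlt : ∀ y ∈ convexHull ℝ V, y ∉ F → l y < l x₀ := by
    intro y hy hyF
    by_contra hcon
    push Not at hcon
    apply hyF
    rw [hl]
    rw [hl] at hx₀
    exact ⟨hy, fun z hz => (hx₀.2 z hz).trans hcon⟩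
  set W := V \ F with hW
  have hWF : ∀ y ∈ convexHull ℝ W, y ∈ convexHull ℝ V ∧ y ∉ F := by
    have h1 : convexHull ℝ W ⊆ convexHull ℝ V ∩ {y | l y < l x₀} := by
      refine convexHull_min ?_ ((convex_convexHull ℝ V).inter (convex_halfSpace_lt l.isLinear _))
      rintro y ⟨hy, hyF⟩
      exact ⟨subset_convexHull ℝ V hy, hlt y (subset_convexHull ℝ V hy) hyF⟩
    intro y hy
    refine ⟨(h1 hy).1, fun hyF => ?_⟩
    have h2 : l y < l x₀ := (h1 hy).2
    rw [hl] at hyF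
    exact absurd (hyF.2 x₀ (hFP hx₀)) (not_le.2 h2)
  -- A point `y` violating this could be mixed with a point of `F` so that the mixture has the image
  -- of some `x ∈ F`. Fiber triviality makes the mixture equal to `x`, although `l` is strictly
  -- below its maximum there.
  have hdisj : Disjoint (π '' convexHull ℝ W) (affineSpan ℝ (π '' F) : Set E') := by
    rw [Set.disjoint_left]
    rintro _ ⟨y, hy, rfl⟩ hz
    obtain ⟨t, ht, _, ⟨x, hx, rfl⟩, _, ⟨x', hx', rfl⟩, he⟩ :=
      (hFc.linear_image π).exists_add_smul_sub_of_mem_affineSpan hz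
    have hp : 0 < 1 + t := by linarith
    obtain ⟨hyP, hyF⟩ := hWF y hy
    have hs : 1 / (1 + t) + t / (1 + t) = 1 := by field_simp
    have hmem : (1 / (1 + t)) • y + (t / (1 + t)) • x' ∈ convexHull ℝ V :=
      convex_convexHull ℝ V hyP (hFP hx') (by positivity) (by positivity) hs
    have heq : x = (1 / (1 + t)) • y + (t / (1 + t)) • x' := by
      refine h x hx _ hmem ?_
      rw [map_add, map_smul, map_smul, he, smul_sub, smul_smul, smul_smul,
        one_div_mul_cancel hp.ne', one_smul, one_div_mul_eq_div, sub_add_cancel]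
    have hlx : l x = (1 / (1 + t)) * l y + (t / (1 + t)) * l x' := by
      rw [heq]; simp
    have h1 := hlt y hyP hyF
    have h2 : l x' ≤ l x₀ := by
      have := hx₀; rw [hl] at this
      exact this.2 _ (hFP hx')
    have h3 : l x₀ ≤ l x := by
      have := hx; rw [hl] at this
      exact this.2 _ (hFP hx₀)
    have h4 : 0 < 1 / (1 + t) := by positivity
    have h5 : 0 ≤ t / (1 + t) := by positivity
    have h6 := mul_lt_mul_of_pos_left h1 h4
    have h7 := mul_le_mul_of_nonneg_left h2 h5
    have h8 : (1 / (1 + t)) * l x₀ + (t / (1 + t)) * l x₀ = l x₀ := by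
      rw [← add_mul, hs, one_mul]
    linarith
  obtain ⟨f, u, v, hfu, huv, hvf⟩ := geometric_hahn_banach_compact_closed
    ((convex_convexHull ℝ W).linear_image π)
    (((hV.subset Set.sdiff_subset).isCompact_convexHull ℝ).image
      (LinearMap.continuous_of_finiteDimensional π))
    (affineSpan ℝ (π '' F)).convex (AffineSubspace.closed_of_finiteDimensional _) hdisj
  have hconst : ∀ x ∈ F, f (π x) = f (π x₀) := by
    intro x hx
    by_contra hne
    have hd : f (π x) - f (π x₀) ≠ 0 := sub_ne_zero.2 hne
    -- If `f` varied on the affine span, the line through the two images would contain a point where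
    -- `f` is exactly `v`, against the strict bound.
    have hm := hvf (AffineMap.lineMap (π x₀) (π x) ((v - f (π x₀)) / (f (π x) - f (π x₀))))
      (AffineMap.lineMap_mem _ (mem_affineSpan ℝ ⟨x₀, hx₀, rfl⟩) (mem_affineSpan ℝ ⟨x, hx, rfl⟩))
    rw [AffineMap.lineMap_apply] at hm
    simp only [vsub_eq_sub, vadd_eq_add, map_add, map_smul, map_sub, smul_eq_mul,
      div_mul_cancel₀ _ hd] at hm
    linarith
  have hvx : v < f (π x₀) := hvf _ (mem_affineSpan ℝ ⟨x₀, hx₀, rfl⟩)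
  have hle : ∀ y ∈ convexHull ℝ V, f (π y) ≤ f (π x₀) := by
    intro y hy
    have : convexHull ℝ V ⊆ {y | (f.toLinearMap ∘ₗ π) y ≤ f (π x₀)} := by
      refine convexHull_min ?_ (convex_halfSpace_le (f.toLinearMap ∘ₗ π).isLinear _)
      intro z hz
      by_cases hzF : z ∈ F
      · exact (hconst z hzF).le
      · have := hfu _ ⟨z, subset_convexHull ℝ W ⟨hz, hzF⟩, rfl⟩
        change f (π z) ≤ _
        linarith
    exact this hy
  have hVF : convexHull ℝ V ⊆ {y | f (π y) = f (π x₀) → y ∈ F} := by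
    intro y hy hfy
    have hy' := hy
    have hcov : V ⊆ (V ∩ F) ∪ W := fun z hz => by
      by_cases hzF : z ∈ F
      · exact Or.inl ⟨hz, hzF⟩
      · exact Or.inr ⟨hz, hzF⟩
    rcases (V ∩ F).eq_empty_or_nonempty with h1 | h1
    · have : y ∈ convexHull ℝ W := convexHull_mono (by simpa [h1] using hcov) hy
      have := hfu _ ⟨y, this, rfl⟩
      linarith
    rcases W.eq_empty_or_nonempty with h2 | h2
    · have : y ∈ convexHull ℝ (V ∩ F) := convexHull_mono (by simpa [h2] using hcov) hy
      exact convexHull_min Set.inter_subset_right hFc this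
    have := convexHull_mono hcov hy
    rw [convexHull_union h1 h2, mem_convexJoin] at this
    obtain ⟨a, ha, b, hb, a', b', ha', hb', hab, rfl⟩ := this
    have haF : a ∈ F := convexHull_min Set.inter_subset_right hFc ha
    have hfa := hconst a haF
    have hfb := hfu _ ⟨b, hb, rfl⟩
    simp only [map_add, map_smul, smul_eq_mul, hfa] at hfy
    have hb0 : b' = 0 := by
      by_contra hb0
      have hbpos : 0 < b' := lt_of_le_of_ne hb' (Ne.symm hb0)
      have ha1 : a' = 1 - b' := by linarith
      rw [ha1] at hfy
      nlinarith
    have ha1 : a' = 1 := by linarith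
    simpa [hb0, ha1] using haF
  refine ⟨f, ?_⟩
  ext z
  constructor
  · rintro ⟨x, hx, rfl⟩
    refine ⟨⟨x, hFP hx, rfl⟩, ?_⟩
    rintro _ ⟨y, hy, rfl⟩
    rw [hconst x hx]
    exact hle y hy
  · rintro ⟨⟨y, hy, rfl⟩, hmax⟩
    exact ⟨y, hVF hy (le_antisymm (hle y hy) (hmax _ ⟨x₀, hFP hx₀, rfl⟩)), rfl⟩

theorem strictlyPreserved_of_fiber_trivial {V : Set E} (hV : V.Finite) {F : Set E}
    (hF : IsFace (convexHull ℝ V) F) (π : E →ₗ[ℝ] E')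
    (h : ∀ x ∈ F, ∀ y ∈ convexHull ℝ V, π x = π y → x = y) :
    StrictlyPreserved π (convexHull ℝ V) F := by
  have hFP : F ⊆ convexHull ℝ V := IsExposed.subset hF
  refine ⟨isFace_image_of_fiber_trivial hV hF π h, ?_,
    combIso_image_of_injOn (IsExposed.convex hF (convex_convexHull ℝ V)) π
      fun x hx y hy => h x hx y (hFP hy)⟩
  ext y
  constructor
  · rintro ⟨hy, x, hx, hxy⟩
    rwa [← h x hx y hy hxy]
  · exact fun hy => ⟨hFP hy, y, hy, rfl⟩

end FacesUnderLinearMaps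

/-! ### The hypersimplex as a slice of the cube, and zero-sum directions. -/

section ZeroOneVectors

variable {n : ℕ}

theorem exists_pos_add_mul_mem_Icc {ι : Type*} [Finite ι] {x v : ι → ℝ}
    (hx : ∀ j, 0 ≤ x j ∧ x j ≤ 1) (h0 : ∀ j, x j = 0 → 0 ≤ v j) (h1 : ∀ j, x j = 1 → v j ≤ 0) :
    ∃ ε : ℝ, 0 < ε ∧ ∀ j, 0 ≤ x j + ε * v j ∧ x j + ε * v j ≤ 1 := by
  have hev : ∀ᶠ ε : ℝ in nhdsWithin 0 (Set.Ioi 0),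
      ∀ j, 0 ≤ x j + ε * v j ∧ x j + ε * v j ≤ 1 := by
    rw [Filter.eventually_all]
    intro j
    have hc : Filter.Tendsto (fun ε : ℝ => x j + ε * v j) (nhdsWithin 0 (Set.Ioi 0))
        (nhds (x j)) := by
      have : Continuous fun ε : ℝ => x j + ε * v j := by fun_prop
      simpa using (this.tendsto 0).mono_left nhdsWithin_le_nhds
    refine Filter.Eventually.and ?_ ?_
    · rcases (hx j).1.eq_or_lt' with h | h
      · filter_upwards [self_mem_nhdsWithin] with ε hε
        rw [h, zero_add]
        exact mul_nonneg (le_of_lt hε) (h0 j h)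
      · exact (hc.eventually (lt_mem_nhds h)).mono fun _ h => h.le
    · rcases (hx j).2.eq_or_lt with h | h
      · filter_upwards [self_mem_nhdsWithin] with ε hε
        have := mul_nonpos_of_nonneg_of_nonpos (le_of_lt hε) (h1 j h)
        linarith
      · exact (hc.eventually (gt_mem_nhds h)).mono fun _ h => h.le
  obtain ⟨ε, h, hε⟩ := (hev.and self_mem_nhdsWithin).exists
  exact ⟨ε, hε, h⟩

theorem finite_zeroOne (n k : ℕ) :
    {x : Fin n → ℝ | (∀ j, x j = 0 ∨ x j = 1) ∧ ∑ j, x j = (k : ℝ)}.Finite := by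
  refine (Set.Finite.pi' (t := fun _ : Fin n => ({0, 1} : Set ℝ)) fun _ => by simp).subset ?_
  rintro x ⟨hx, -⟩ j
  simpa using hx j

theorem convex_unitCube_slice (n k : ℕ) :
    Convex ℝ {x : Fin n → ℝ | (∀ j, 0 ≤ x j ∧ x j ≤ 1) ∧ ∑ j, x j = (k : ℝ)} := by
  rintro x ⟨hx, hxs⟩ y ⟨hy, hys⟩ a b ha hb hab
  refine ⟨fun j => ⟨?_, ?_⟩, ?_⟩
  · have := mul_nonneg ha (hx j).1
    have := mul_nonneg hb (hy j).1
    simp only [Pi.add_apply, Pi.smul_apply, smul_eq_mul]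
    linarith
  · have := mul_le_mul_of_nonneg_left (hx j).2 ha
    have := mul_le_mul_of_nonneg_left (hy j).2 hb
    simp only [Pi.add_apply, Pi.smul_apply, smul_eq_mul]
    linarith
  · simp only [Pi.add_apply, Pi.smul_apply, smul_eq_mul, Finset.sum_add_distrib,
      ← Finset.mul_sum, hxs, hys, ← add_mul, hab, one_mul]

theorem isCompact_unitCube_slice (n k : ℕ) :
    IsCompact {x : Fin n → ℝ | (∀ j, 0 ≤ x j ∧ x j ≤ 1) ∧ ∑ j, x j = (k : ℝ)} := by
  have h : IsCompact (Set.univ.pi fun _ : Fin n => Set.Icc (0 : ℝ) 1) :=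
    isCompact_univ_pi fun _ => isCompact_Icc
  have h2 : IsClosed {x : Fin n → ℝ | ∑ j, x j = (k : ℝ)} :=
    isClosed_eq (by fun_prop) continuous_const
  convert h.inter_right h2 using 1
  ext x
  simp only [Set.mem_ofPred_eq, Set.mem_inter_iff, Set.mem_univ_pi, Set.mem_Icc]

theorem sum_single_sub_single {a b : Fin n} :
    ∑ j, ((Pi.single a 1 - Pi.single b 1 : Fin n → ℝ) j) = 0 := by
  simp [Finset.sum_sub_distrib]

/-- The sum is an integer, so a fractional coordinate never comes alone. Moving mass between two
fractional coordinates in both directions contradicts extremality. -/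
theorem zeroOne_of_mem_extremePoints {k : ℕ} {x : Fin n → ℝ}
    (hx : x ∈ Set.extremePoints ℝ
      {x : Fin n → ℝ | (∀ j, 0 ≤ x j ∧ x j ≤ 1) ∧ ∑ j, x j = (k : ℝ)}) (a : Fin n) :
    x a = 0 ∨ x a = 1 := by
  rw [mem_extremePoints] at hx
  obtain ⟨⟨hx01, hxs⟩, hext⟩ := hx
  by_contra ha
  push Not at ha
  obtain ⟨b, hba, hb⟩ : ∃ b, b ≠ a ∧ (x b ≠ 0 ∧ x b ≠ 1) := by
    by_contra hcon
    push Not at hcon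
    have hint : ∃ m : ℤ, ∑ j ∈ Finset.univ.erase a, x j = m := by
      refine Finset.sum_induction x (fun r => ∃ m : ℤ, r = m) ?_ ⟨0, by simp⟩ ?_
      · rintro _ _ ⟨m, rfl⟩ ⟨m', rfl⟩
        exact ⟨m + m', by push_cast; rfl⟩
      · intro j hj
        by_cases h : x j = 0
        · exact ⟨0, by simp [h]⟩
        · exact ⟨1, by simp [hcon j (Finset.ne_of_mem_erase hj) h]⟩
    obtain ⟨m, hm⟩ := hint
    have hsum := Finset.add_sum_erase Finset.univ x (Finset.mem_univ a)
    rw [hxs, hm] at hsum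
    have hxa : x a = ((k - m : ℤ) : ℝ) := by push_cast; linarith
    have h1 : (0 : ℝ) < ((k - m : ℤ) : ℝ) := hxa ▸ lt_of_le_of_ne (hx01 a).1 (Ne.symm ha.1)
    have h2 : ((k - m : ℤ) : ℝ) < 1 := hxa ▸ lt_of_le_of_ne (hx01 a).2 ha.2
    have h3 : (0 : ℤ) < k - m := by exact_mod_cast h1
    have h4 : (k - m : ℤ) < 1 := by exact_mod_cast h2
    omega
  have hfrac : ∀ j (c : ℝ), x j = c → (c = 0 ∨ c = 1) → j ≠ a ∧ j ≠ b := by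
    rintro j c hj hc
    constructor
    · rintro rfl
      rcases hc with rfl | rfl
      · exact ha.1 hj
      · exact ha.2 hj
    · rintro rfl
      rcases hc with rfl | rfl
      · exact hb.1 hj
      · exact hb.2 hj
  set v : Fin n → ℝ := Pi.single a 1 - Pi.single b 1 with hv
  have hv0 : ∀ j, j ≠ a ∧ j ≠ b → v j = 0 := by
    rintro j ⟨h1, h2⟩
    simp [hv, h1, h2]
  obtain ⟨ε, hε, hp⟩ := exists_pos_add_mul_mem_Icc (v := v) hx01
    (fun j hj => (hv0 j (hfrac j _ hj (Or.inl rfl))).ge)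
    (fun j hj => (hv0 j (hfrac j _ hj (Or.inr rfl))).le)
  obtain ⟨δ, hδ, hm⟩ := exists_pos_add_mul_mem_Icc (v := -v) hx01
    (fun j hj => by simp [hv0 j (hfrac j _ hj (Or.inl rfl))])
    (fun j hj => by simp [hv0 j (hfrac j _ hj (Or.inr rfl))])
  have hvs : ∑ j, v j = 0 := sum_single_sub_single
  have h := hext (x + ε • v) ⟨hp, by
      simp [Finset.sum_add_distrib, ← Finset.mul_sum, hvs, hxs]⟩
    (x + δ • (-v)) ⟨hm, by
      simp only [Pi.add_apply, Pi.smul_apply, Pi.neg_apply, smul_eq_mul,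
        Finset.sum_add_distrib, ← Finset.mul_sum, Finset.sum_neg_distrib, hvs, hxs]
      simp⟩ (by
      refine ⟨δ / (ε + δ), ε / (ε + δ), by positivity, by positivity, by field_simp; ring, ?_⟩
      ext j
      simp only [Pi.add_apply, Pi.smul_apply, Pi.neg_apply, smul_eq_mul]
      field_simp
      ring)
  have h1 := congrFun h.1 a
  simp only [Pi.add_apply, Pi.smul_apply, smul_eq_mul, hv, Pi.sub_apply, Pi.single_eq_same,
    Pi.single_eq_of_ne hba.symm] at h1
  linarith

theorem hypersimplex_eq (n k : ℕ) :
    hypersimplex n k = {x | (∀ j, 0 ≤ x j ∧ x j ≤ 1) ∧ ∑ j, x j = (k : ℝ)} := by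
  apply subset_antisymm
  · refine convexHull_min ?_ (convex_unitCube_slice n k)
    rintro x ⟨hx, hs⟩
    refine ⟨fun j => ?_, hs⟩
    rcases hx j with h | h <;> simp [h]
  · rw [← closure_convexHull_extremePoints (isCompact_unitCube_slice n k)
      (convex_unitCube_slice n k)]
    refine closure_minimal (convexHull_mono fun x hx => ?_)
      ((finite_zeroOne n k).isCompact_convexHull ℝ).isClosed
    exact ⟨zeroOne_of_mem_extremePoints hx, (extremePoints_subset hx).2⟩

theorem mem_hypersimplex {k : ℕ} {x : Fin n → ℝ} :
    x ∈ hypersimplex n k ↔ (∀ j, 0 ≤ x j ∧ x j ≤ 1) ∧ ∑ j, x j = (k : ℝ) := by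
  rw [hypersimplex_eq]; rfl

theorem exists_pos_add_smul_mem_hypersimplex {k : ℕ} {x v : Fin n → ℝ}
    (hx : x ∈ hypersimplex n k) (hv : ∑ j, v j = 0)
    (h0 : ∀ j, x j = 0 → 0 ≤ v j) (h1 : ∀ j, x j = 1 → v j ≤ 0) :
    ∃ ε : ℝ, 0 < ε ∧ x + ε • v ∈ hypersimplex n k := by
  rw [mem_hypersimplex] at hx
  obtain ⟨ε, hε, h⟩ := exists_pos_add_mul_mem_Icc hx.1 h0 h1
  refine ⟨ε, hε, mem_hypersimplex.2 ⟨h, ?_⟩⟩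
  simp [Finset.sum_add_distrib, ← Finset.mul_sum, hv, hx.2]

/-- The vectors supported on `T` with coordinate sum zero. -/
def zeroSumOn (T : Finset (Fin n)) : Submodule ℝ (Fin n → ℝ) where
  carrier := {v | (∀ j ∉ T, v j = 0) ∧ ∑ j, v j = 0}
  add_mem' := by
    rintro v w ⟨hv, hv'⟩ ⟨hw, hw'⟩
    exact ⟨fun j hj => by simp [hv j hj, hw j hj], by simp [Finset.sum_add_distrib, hv', hw']⟩
  zero_mem' := by simp
  smul_mem' := by
    rintro c v ⟨hv, hv'⟩
    exact ⟨fun j hj => by simp [hv j hj], by simp [← Finset.mul_sum, hv']⟩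

/-- The coordinate sum as a linear functional. -/
def coordSum (ι : Type*) [Fintype ι] : (ι → ℝ) →ₗ[ℝ] ℝ := ∑ j, LinearMap.proj j

@[simp] theorem coordSum_apply {ι : Type*} [Fintype ι] (x : ι → ℝ) :
    coordSum ι x = ∑ j, x j := by simp [coordSum]

theorem sum_eq_sum_subtype_of_support {T : Finset (Fin n)} {v : Fin n → ℝ}
    (hv : ∀ j ∉ T, v j = 0) : ∑ j, v j = ∑ j : T, v j := by
  rw [Finset.sum_coe_sort T v]
  exact (Finset.sum_subset (Finset.subset_univ T) fun j _ hj => hv j hj).symm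

/-- Restriction to `T` identifies `zeroSumOn T` with the zero-sum vectors indexed by `T`. -/
def zeroSumOnEquiv (T : Finset (Fin n)) : zeroSumOn T ≃ₗ[ℝ] (coordSum T).ker where
  toFun v := ⟨fun j => v.1 j, by
    rw [LinearMap.mem_ker, coordSum_apply, ← sum_eq_sum_subtype_of_support v.2.1, v.2.2]⟩
  map_add' _ _ := rfl
  map_smul' _ _ := rfl
  invFun w := ⟨fun j => if h : j ∈ T then w.1 ⟨j, h⟩ else 0, by
    have h0 : ∀ j ∉ T, (if h : j ∈ T then w.1 ⟨j, h⟩ else 0) = 0 := fun j hj => dif_neg hj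
    refine ⟨h0, ?_⟩
    rw [sum_eq_sum_subtype_of_support h0]
    have := w.2
    rw [LinearMap.mem_ker, coordSum_apply] at this
    simpa using this⟩
  left_inv v := by
    ext j
    by_cases h : j ∈ T
    · simp [h]
    · simp [h, v.2.1 j h]
  right_inv w := by
    ext j
    simp

/-- Truncated subtraction gives the right value 0 for empty `T` as well. -/
theorem finrank_zeroSumOn (T : Finset (Fin n)) :
    Module.finrank ℝ (zeroSumOn T) = T.card - 1 := by
  rw [(zeroSumOnEquiv T).finrank_eq]
  rcases T.eq_empty_or_nonempty with rfl | ⟨a, ha⟩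
  · have : Subsingleton ((∅ : Finset (Fin n)) → ℝ) := ⟨fun x y => by ext ⟨j, hj⟩; simp at hj⟩
    simp [Module.finrank_zero_of_subsingleton]
  · have hne : coordSum T ≠ 0 := by
      intro h
      have := LinearMap.congr_fun h (Pi.single ⟨a, ha⟩ 1)
      simp at this
    have := Module.Dual.finrank_ker_add_one_of_ne_zero (f := coordSum T) hne
    rw [Module.finrank_fintype_fun_eq_card, Fintype.card_coe] at this
    exact Nat.eq_sub_of_add_eq this

end ZeroOneVectors

/-! ### The quotient by the all-ones vector, and dependences. -/

section Quotient

variable {n d : ℕ}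

instance quotSpace_t2Space (n : ℕ) : T2Space (QuotSpace n) := by
  have : IsClosed ((Submodule.span ℝ {(fun _ => 1 : Fin n → ℝ)} :
    Submodule ℝ (Fin n → ℝ)) : Set (Fin n → ℝ)) := Submodule.closed_of_finiteDimensional _
  infer_instance

/-- The quotient map `ℝⁿ → ℝⁿ / ℝ·(1,…,1)`. -/
def quotMap (n : ℕ) : (Fin n → ℝ) →ₗ[ℝ] QuotSpace n :=
  Submodule.mkQ (Submodule.span ℝ {(fun _ => 1 : Fin n → ℝ)})

theorem quotMap_surjective (n : ℕ) : Function.Surjective (quotMap n) :=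
  Submodule.mkQ_surjective _

theorem quotMap_one (n : ℕ) : quotMap n (fun _ => 1) = 0 := by
  rw [quotMap, Submodule.mkQ_apply, Submodule.Quotient.mk_eq_zero]
  exact Submodule.mem_span_singleton_self _

theorem eq_zero_of_quotMap_eq_zero {v : Fin n → ℝ} (h : quotMap n v = 0) (hs : ∑ j, v j = 0) :
    v = 0 := by
  rw [quotMap, Submodule.mkQ_apply, Submodule.Quotient.mk_eq_zero,
    Submodule.mem_span_singleton] at h
  obtain ⟨c, rfl⟩ := h
  rcases Nat.eq_zero_or_pos n with rfl | hn
  · ext j; exact j.elim0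
  · have : (n : ℝ) * c = 0 := by simpa using hs
    rcases mul_eq_zero.1 this with h | h
    · exact absurd h (by positivity)
    · simp [h]

theorem eq_of_quotMap_eq {k : ℕ} {x y : Fin n → ℝ} (hx : x ∈ hypersimplex n k)
    (hy : y ∈ hypersimplex n k) (h : quotMap n x = quotMap n y) : x = y := by
  rw [← sub_eq_zero]
  refine eq_zero_of_quotMap_eq_zero (by rw [map_sub, h, sub_self]) ?_
  simp [Finset.sum_sub_distrib, (mem_hypersimplex.1 hx).2, (mem_hypersimplex.1 hy).2]

theorem quotHypersimplex_eq_image (n k : ℕ) :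
    quotHypersimplex n k = quotMap n '' hypersimplex n k := rfl

theorem quotHypersimplex_eq_convexHull (n k : ℕ) :
    quotHypersimplex n k = convexHull ℝ
      (quotMap n '' {x | (∀ j, x j = 0 ∨ x j = 1) ∧ ∑ j, x j = (k : ℝ)}) := by
  rw [quotHypersimplex_eq_image, hypersimplex, LinearMap.image_convexHull]

/-- The linear dependences with zero coordinate sum among the points of the configuration
of `π`. -/
def depSpace (π : QuotSpace n →ₗ[ℝ] (Fin d → ℝ)) : Submodule ℝ (Fin n → ℝ) :=
  (coordSum (Fin n)).ker ⊓ (π ∘ₗ quotMap n).ker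

theorem mem_depSpace {π : QuotSpace n →ₗ[ℝ] (Fin d → ℝ)} {v : Fin n → ℝ} :
    v ∈ depSpace π ↔ ∑ j, v j = 0 ∧ π (quotMap n v) = 0 := by
  simp [depSpace]

/-- The number of negative coordinates. -/
noncomputable def numNeg (v : Fin n → ℝ) : ℕ := (Finset.univ.filter fun j => v j < 0).card

/-- The number of positive coordinates. -/
noncomputable def numPos (v : Fin n → ℝ) : ℕ := (Finset.univ.filter fun j => 0 < v j).card

end Quotient

/-! ### The sign criterion for preserving skeleta. -/

section Criterion

variable {n d k i : ℕ}

theorem exists_pos_of_sum_eq_zero {v : Fin n → ℝ} (hv : v ≠ 0) (hs : ∑ j, v j = 0) :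
    ∃ j, 0 < v j := by
  by_contra h
  push Not at h
  refine hv (funext fun j => ?_)
  exact (Finset.sum_eq_zero_iff_of_nonpos fun j _ => h j).1 hs j (Finset.mem_univ j)

theorem exists_neg_of_sum_eq_zero {v : Fin n → ℝ} (hv : v ≠ 0) (hs : ∑ j, v j = 0) :
    ∃ j, v j < 0 := by
  obtain ⟨j, hj⟩ := exists_pos_of_sum_eq_zero (neg_ne_zero.2 hv) (by simp [hs])
  exact ⟨j, by simpa using hj⟩

/-- The face of the hypersimplex on which the coordinates in `I` are one and those in `J` zero. -/
def quotFace (n k : ℕ) (I J : Finset (Fin n)) : Set (QuotSpace n) :=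
  quotMap n '' {x ∈ hypersimplex n k | (∀ j ∈ I, x j = 1) ∧ ∀ j ∈ J, x j = 0}

theorem exists_functional_quotSpace (hn : 0 < n) (c : (Fin n → ℝ) →ₗ[ℝ] ℝ) :
    ∃ l : StrongDual ℝ (QuotSpace n), ∀ x, l (quotMap n x) = c x - (c 1 / n) * ∑ j, x j := by
  -- The multiple of the coordinate sum is chosen to kill the all-ones vector; on the hypersimplex
  -- the correction is a constant.
  let c' : (Fin n → ℝ) →ₗ[ℝ] ℝ := c - (c 1 / n) • coordSum (Fin n)
  have hc' : Submodule.span ℝ {(fun _ => 1 : Fin n → ℝ)} ≤ c'.ker := by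
    rw [Submodule.span_le, Set.singleton_subset_iff, SetLike.mem_coe, LinearMap.mem_ker]
    have hn' : (n : ℝ) ≠ 0 := by positivity
    have h1 : (fun _ => 1 : Fin n → ℝ) = 1 := rfl
    simp [c', h1, hn']
  refine ⟨LinearMap.toContinuousLinearMap (Submodule.liftQ _ c' hc'), fun x => ?_⟩
  simp [quotMap, c']

/-- The functional summing over `I` and subtracting the sum over `J` is at most `I.card`, with
equality exactly on this set. -/
theorem isFace_quotFace (hn : 0 < n) (I J : Finset (Fin n)) :
    IsFace (quotHypersimplex n k) (quotFace n k I J) := by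
  rintro ⟨_, x₀, ⟨hx₀, hI₀, hJ₀⟩, rfl⟩
  let c : (Fin n → ℝ) →ₗ[ℝ] ℝ :=
    ∑ j ∈ I, LinearMap.proj j - ∑ j ∈ J, LinearMap.proj j
  have hc : ∀ x, c x = ∑ j ∈ I, x j - ∑ j ∈ J, x j := fun x => by simp [c]
  obtain ⟨l, hl⟩ := exists_functional_quotSpace hn c
  have hl' : ∀ x ∈ hypersimplex n k, l (quotMap n x) = c x - (c 1 / n) * k := by
    intro x hx
    rw [hl, (mem_hypersimplex.1 hx).2]
  have hc₀ : c x₀ = I.card := by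
    rw [hc, Finset.sum_congr rfl hI₀, Finset.sum_congr rfl hJ₀]
    simp
  have hI : ∀ x ∈ hypersimplex n k, ∑ j ∈ I, x j ≤ I.card := fun x hx => by
    simpa using Finset.sum_le_card_nsmul I x 1 fun j _ => ((mem_hypersimplex.1 hx).1 j).2
  have hJ : ∀ x ∈ hypersimplex n k, 0 ≤ ∑ j ∈ J, x j := fun x hx =>
    Finset.sum_nonneg fun j _ => ((mem_hypersimplex.1 hx).1 j).1
  refine ⟨l, ?_⟩
  ext z
  constructor
  · rintro ⟨x, ⟨hx, hxI, hxJ⟩, rfl⟩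
    refine ⟨⟨x, hx, rfl⟩, ?_⟩
    rintro _ ⟨y, hy, rfl⟩
    change l (quotMap n y) ≤ _
    rw [hl' x hx, hl' y hy, hc x, hc y, Finset.sum_congr rfl hxI, Finset.sum_congr rfl hxJ]
    have := hI y hy
    have := hJ y hy
    simp only [Finset.sum_const, nsmul_eq_mul, mul_one, mul_zero]
    linarith
  · rintro ⟨⟨x, hx, rfl⟩, hmax⟩
    have h := hmax _ ⟨x₀, hx₀, rfl⟩
    change l (quotMap n x₀) ≤ l (quotMap n x) at h
    rw [hl' x hx, hl' x₀ hx₀, hc₀, hc x] at h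
    have h1 := hI x hx
    have h2 := hJ x hx
    refine ⟨x, ⟨hx, ?_, ?_⟩, rfl⟩
    · have h3 : ∑ j ∈ I, (1 - x j) = 0 := by
        rw [Finset.sum_sub_distrib]
        simp only [Finset.sum_const, nsmul_eq_mul, mul_one]
        linarith
      intro j hj
      have := (Finset.sum_eq_zero_iff_of_nonneg fun j _ => by
        linarith [((mem_hypersimplex.1 hx).1 j).2]).1 h3 j hj
      linarith
    · have h3 : ∑ j ∈ J, x j = 0 := by linarith
      exact (Finset.sum_eq_zero_iff_of_nonneg fun j _ => ((mem_hypersimplex.1 hx).1 j).1).1 h3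

theorem finrank_vectorSpan_quotFace_le (I J : Finset (Fin n)) :
    Module.finrank ℝ (vectorSpan ℝ (quotFace n k I J)) ≤ (I ∪ J)ᶜ.card - 1 := by
  have hle : vectorSpan ℝ (quotFace n k I J) ≤ (zeroSumOn (I ∪ J)ᶜ).map (quotMap n) := by
    refine Submodule.span_le.2 ?_
    rintro _ ⟨_, ⟨x, ⟨hx, hxI, hxJ⟩, rfl⟩, _, ⟨y, ⟨hy, hyI, hyJ⟩, rfl⟩, rfl⟩
    refine ⟨x - y, ⟨fun j hj => ?_, ?_⟩, by simp⟩
    · rw [Finset.mem_compl, not_not, Finset.mem_union] at hj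
      rcases hj with hj | hj
      · simp [hxI j hj, hyI j hj]
      · simp [hxJ j hj, hyJ j hj]
    · simp [Finset.sum_sub_distrib, (mem_hypersimplex.1 hx).2, (mem_hypersimplex.1 hy).2]
  calc _ ≤ _ := Submodule.finrank_mono hle
    _ ≤ Module.finrank ℝ (zeroSumOn (I ∪ J)ᶜ) := Submodule.finrank_map_le _ _
    _ = _ := finrank_zeroSumOn _

theorem exists_mem_hypersimplex_of_card {I J : Finset (Fin n)} (hIJ : Disjoint I J)
    (hI : I.card ≤ k) (hJ : k + J.card ≤ n)
    (hT : (I ∪ J)ᶜ.Nonempty → I.card < k ∧ k + J.card < n) :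
    ∃ x ∈ hypersimplex n k, (∀ j ∈ I, x j = 1) ∧ (∀ j ∈ J, x j = 0) ∧
      ∀ j ∉ I ∪ J, 0 < x j ∧ x j < 1 := by
  classical
  set T := (I ∪ J)ᶜ with hTdef
  have hcard : T.card + (I.card + J.card) = n := by
    rw [← Finset.card_union_of_disjoint hIJ, hTdef, Finset.card_compl_add_card, Fintype.card_fin]
  have hcardR : (T.card : ℝ) + (I.card + J.card) = n := by exact_mod_cast hcard
  -- The mass not used by `I` is spread evenly over the free coordinates.
  set θ : ℝ := (k - I.card) / T.card with hθ
  have hθ01 : T.Nonempty → 0 < θ ∧ θ < 1 := by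
    intro hne
    obtain ⟨h1, h2⟩ := hT hne
    have hTpos : (0 : ℝ) < T.card := by exact_mod_cast hne.card_pos
    have h1' : (I.card : ℝ) < k := by exact_mod_cast h1
    have h2' : (k : ℝ) + J.card < n := by exact_mod_cast h2
    refine ⟨div_pos (by linarith) hTpos, ?_⟩
    rw [hθ, div_lt_one hTpos]
    linarith
  have hTmem : ∀ j, j ∈ T ↔ j ∉ I ∪ J := fun j => Finset.mem_compl
  refine ⟨fun j => if j ∈ I then 1 else if j ∈ J then 0 else θ, ?_, ?_, ?_, ?_⟩
  · rw [mem_hypersimplex]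
    constructor
    · intro j
      by_cases h1 : j ∈ I
      · simp [h1]
      by_cases h2 : j ∈ J
      · simp [h1, h2]
      have := hθ01 ⟨j, (hTmem j).2 (by simp [h1, h2])⟩
      simp only [h1, h2, if_false]
      exact ⟨this.1.le, this.2.le⟩
    · have hf : ∀ j, (if j ∈ I then (1 : ℝ) else if j ∈ J then 0 else θ) =
          (if j ∈ I then 1 else 0) + if j ∈ T then θ else 0 := by
        intro j
        by_cases h1 : j ∈ I
        · simp [h1, hTmem]
        by_cases h2 : j ∈ J
        · simp [h1, h2, hTmem]
        simp [h1, h2, hTmem]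
      simp only [hf, Finset.sum_add_distrib, Finset.sum_ite_mem, Finset.univ_inter,
        Finset.sum_const, nsmul_eq_mul, mul_one]
      rcases T.eq_empty_or_nonempty with h0 | h0
      · have : I.card = k := by
          rw [h0, Finset.card_empty] at hcard
          omega
        simp [h0, this]
      · have hTpos : (0 : ℝ) < T.card := by exact_mod_cast h0.card_pos
        rw [hθ]
        field_simp
        ring
  · intro j hj
    simp [hj]
  · intro j hj
    have : j ∉ I := fun h => Finset.disjoint_left.1 hIJ h hj
    simp [hj, this]
  · intro j hj
    have := hθ01 ⟨j, (hTmem j).2 hj⟩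
    rw [Finset.mem_union, not_or] at hj
    simpa [hj.1, hj.2] using this

/-- Start at a point of the face whose free coordinates are strictly between 0 and 1. The sign
conditions keep a small step along `v` inside the hypersimplex; the step does not change the image,
yet it leaves the face because `v` is nonzero on a fixed coordinate. -/
theorem not_isIPreserving_of_mem_depSpace (hn : 0 < n) {π : QuotSpace n →ₗ[ℝ] (Fin d → ℝ)}
    {v : Fin n → ℝ} (hv : v ∈ depSpace π) {I J : Finset (Fin n)} (hIJ : Disjoint I J)
    (hvI : ∀ j ∈ I, v j ≤ 0) (hvJ : ∀ j ∈ J, 0 ≤ v j) (hne : ∃ j ∈ I ∪ J, v j ≠ 0)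
    (hi : (I ∪ J)ᶜ.card ≤ i + 1) (hI : I.card ≤ k) (hJ : k + J.card ≤ n)
    (hT : (I ∪ J)ᶜ.Nonempty → I.card < k ∧ k + J.card < n) : ¬ IsIPreserving π k i := by
  intro h
  rw [mem_depSpace] at hv
  obtain ⟨x, hx, hxI, hxJ, hxT⟩ := exists_mem_hypersimplex_of_card hIJ hI hJ hT
  obtain ⟨ε, hε, hxv⟩ := exists_pos_add_smul_mem_hypersimplex hx hv.1
    (fun j hj => by
      by_cases h1 : j ∈ I
      · rw [hxI j h1] at hj; norm_num at hj
      by_cases h2 : j ∈ J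
      · exact hvJ j h2
      · have := (hxT j (by simp [h1, h2])).1
        linarith)
    (fun j hj => by
      by_cases h1 : j ∈ J
      · rw [hxJ j h1] at hj; norm_num at hj
      by_cases h2 : j ∈ I
      · exact hvI j h2
      · have := (hxT j (by simp [h1, h2])).2
        linarith)
  have hpres := (h (quotFace n k I J) (isFace_quotFace hn I J)
    ((finrank_vectorSpan_quotFace_le I J).trans (by omega))).2.1
  have hmem : quotMap n (x + ε • v) ∈ quotFace n k I J := by
    rw [← hpres]
    refine ⟨⟨_, hxv, rfl⟩, quotMap n x, ⟨x, ⟨hx, hxI, hxJ⟩, rfl⟩, ?_⟩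
    rw [map_add, map_add, map_smul, map_smul, hv.2, smul_zero, add_zero]
  obtain ⟨y, ⟨hy, hyI, hyJ⟩, hyx⟩ := hmem
  have hyx' := eq_of_quotMap_eq hy hxv hyx
  obtain ⟨j, hj, hvj⟩ := hne
  have hyj : y j = x j + ε * v j := by rw [hyx']; simp
  have : ε * v j = 0 := by
    rcases Finset.mem_union.1 hj with hj | hj
    · rw [hyI j hj, hxI j hj] at hyj; linarith
    · rw [hyJ j hj, hxJ j hj] at hyj; linarith
  rcases mul_eq_zero.1 this with h | h
  · exact hε.ne' h
  · exact hvj h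

/-- If both counts are small, one can fix coordinates compatibly with the signs of `v` and leave at
most `i + 1` free, so the face has dimension at most `i`. -/
theorem lt_numNeg_or_lt_numPos_of_isIPreserving (hk : 1 ≤ k) (hkn : k + 1 ≤ n)
    {π : QuotSpace n →ₗ[ℝ] (Fin d → ℝ)} (h : IsIPreserving π k i) {v : Fin n → ℝ}
    (hv : v ∈ depSpace π) (hv0 : v ≠ 0) : k + i < numNeg v ∨ n + i < numPos v + k := by
  classical
  by_contra hcon
  push Not at hcon
  obtain ⟨hq, hp⟩ := hcon
  have hs := (mem_depSpace.1 hv).1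
  obtain ⟨a, ha⟩ := exists_pos_of_sum_eq_zero hv0 hs
  obtain ⟨b, hb⟩ := exists_neg_of_sum_eq_zero hv0 hs
  set N : Finset (Fin n) := Finset.univ.filter fun j => v j < 0 with hN
  set P : Finset (Fin n) := Finset.univ.filter fun j => 0 < v j with hP
  have hmN : ∀ j, j ∈ N ↔ v j < 0 := fun j => by simp [hN]
  have hmP : ∀ j, j ∈ P ↔ 0 < v j := fun j => by simp [hP]
  have hNP : N ⊆ Pᶜ := fun j hj => by
    rw [Finset.mem_compl, hmP]
    exact not_lt.2 ((hmN j).1 hj).le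
  have hNc := Finset.card_compl_add_card N
  have hPc := Finset.card_compl_add_card P
  rw [Fintype.card_fin] at hNc hPc
  change N.card ≤ k + i at hq
  change P.card + k ≤ n + i at hp
  have hn : 0 < n := by omega
  by_cases h1 : N.card ≤ k
  · by_cases h2 : P.card + k ≤ n
    -- Few signs of both kinds: a vertex already suffices, with `I` between the negative and the
    -- nonpositive coordinates.
    · obtain ⟨I, hNI, hIP, hIc⟩ :=
        Finset.exists_subsuperset_card_eq hNP h1 (by omega)
      have hIcc := Finset.card_compl_add_card I
      rw [Fintype.card_fin] at hIcc
      refine not_isIPreserving_of_mem_depSpace hn hv (I := I) (J := Iᶜ) disjoint_compl_right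
        ?_ ?_ ⟨a, by simp, ha.ne'⟩ (by simp) (by omega) (by omega) (by simp) h
      · intro j hj
        have := hIP hj
        rw [Finset.mem_compl, hmP] at this
        exact not_lt.1 this
      · intro j hj
        rw [Finset.mem_compl] at hj
        by_contra hc
        exact hj (hNI ((hmN j).2 (not_le.1 hc)))
    -- Too many positive coordinates for a vertex. Fixing only `n - k - 1` zeros keeps `k + J.card <
    -- n`, so the free coordinates can be strictly below 1.
    · obtain ⟨J, hJP, hJc⟩ := Finset.exists_subset_card_eq (s := P) (n := n - k - 1) (by omega)
      have hdis : Disjoint Pᶜ J := Finset.disjoint_left.2 fun j hj hj' =>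
        (Finset.mem_compl.1 hj) (hJP hj')
      have hU := Finset.card_compl_add_card (Pᶜ ∪ J)
      rw [Fintype.card_fin, Finset.card_union_of_disjoint hdis] at hU
      refine not_isIPreserving_of_mem_depSpace hn hv hdis
        ?_ ?_ ⟨b, ?_, hb.ne⟩ (by omega) (by omega) (by omega) (fun _ => by omega) h
      · intro j hj
        rw [Finset.mem_compl, hmP] at hj
        exact not_lt.1 hj
      · intro j hj
        exact ((hmP j).1 (hJP hj)).le
      · exact Finset.mem_union_left _ (hNP ((hmN b).2 hb))
  -- Symmetrically, only `k - 1` ones are fixed, leaving positive mass for the free coordinates.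
  · obtain ⟨I, hIN, hIc⟩ := Finset.exists_subset_card_eq (s := N) (n := k - 1) (by omega)
    have hdis : Disjoint I Nᶜ := Finset.disjoint_left.2 fun j hj hj' =>
      (Finset.mem_compl.1 hj') (hIN hj)
    have hU := Finset.card_compl_add_card (I ∪ Nᶜ)
    rw [Fintype.card_fin, Finset.card_union_of_disjoint hdis] at hU
    refine not_isIPreserving_of_mem_depSpace hn hv hdis
      ?_ ?_ ⟨a, ?_, ha.ne'⟩ (by omega) (by omega) (by omega) (fun _ => by omega) h
    · intro j hj
      exact ((hmN j).1 (hIN hj)).le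
    · intro j hj
      rw [Finset.mem_compl, hmN] at hj
      exact not_lt.1 hj
    · refine Finset.mem_union_right _ ?_
      rw [Finset.mem_compl, hmN]
      exact not_lt.2 ha.le

/-- From `x` one can move both ways along any zero-sum vector supported on its fractional
coordinates, so the functional exposing `F` vanishes on such vectors and the moves stay in `F`. -/
theorem map_zeroSumOn_le_vectorSpan {F : Set (QuotSpace n)} (hF : IsFace (quotHypersimplex n k) F)
    {x : Fin n → ℝ} (hx : x ∈ hypersimplex n k) (hxF : quotMap n x ∈ F) {T : Finset (Fin n)}
    (hT : ∀ j ∈ T, 0 < x j ∧ x j < 1) : (zeroSumOn T).map (quotMap n) ≤ vectorSpan ℝ F := by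
  rintro _ ⟨v, ⟨hvT, hvs⟩, rfl⟩
  obtain ⟨l, hl⟩ := hF ⟨_, hxF⟩
  have hzero : ∀ j (c : ℝ), x j = c → (c = 0 ∨ c = 1) → v j = 0 := by
    intro j c hj hc
    refine hvT j fun hjT => ?_
    have := hT j hjT
    rcases hc with rfl | rfl <;> linarith
  obtain ⟨ε, hε, h1⟩ := exists_pos_add_smul_mem_hypersimplex hx hvs
    (fun j hj => (hzero j _ hj (Or.inl rfl)).ge) (fun j hj => (hzero j _ hj (Or.inr rfl)).le)
  obtain ⟨δ, hδ, h2⟩ := exists_pos_add_smul_mem_hypersimplex (v := -v) hx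
    (by simp [hvs])
    (fun j hj => by simp [hzero j _ hj (Or.inl rfl)])
    (fun j hj => by simp [hzero j _ hj (Or.inr rfl)])
  have hx' := hxF
  rw [hl] at hx'
  have h1' := hx'.2 _ ⟨_, h1, rfl⟩
  have h2' := hx'.2 _ ⟨_, h2, rfl⟩
  change l (quotMap n (x + ε • v)) ≤ _ at h1'
  change l (quotMap n (x + δ • (-v))) ≤ _ at h2'
  simp only [map_add, map_smul, map_neg, smul_eq_mul] at h1' h2'
  have hlv : l (quotMap n v) = 0 := by
    refine le_antisymm ?_ ?_
    · by_contra hc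
      have := mul_pos hε (not_le.1 hc)
      linarith
    · by_contra hc
      have := mul_pos hδ (neg_pos.2 (not_le.1 hc))
      linarith
  have hmem : quotMap n (x + ε • v) ∈ F := by
    rw [hl]
    refine ⟨⟨_, h1, rfl⟩, fun y hy => ?_⟩
    have := hx'.2 y hy
    simpa [hlv] using this
  have := (vectorSpan ℝ F).smul_mem ε⁻¹ (vsub_mem_vectorSpan ℝ hmem hxF)
  simpa [smul_smul, inv_mul_cancel₀ hε.ne'] using this

theorem card_le_finrank_vectorSpan_add_one {F : Set (QuotSpace n)}
    (hF : IsFace (quotHypersimplex n k) F) {x : Fin n → ℝ} (hx : x ∈ hypersimplex n k)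
    (hxF : quotMap n x ∈ F) {T : Finset (Fin n)} (hT : ∀ j ∈ T, 0 < x j ∧ x j < 1) :
    T.card ≤ Module.finrank ℝ (vectorSpan ℝ F) + 1 := by
  have hinj : Set.InjOn (quotMap n) (zeroSumOn T) := by
    intro v hv w hw h
    rw [← sub_eq_zero]
    refine eq_zero_of_quotMap_eq_zero (by rw [map_sub, h, sub_self]) ?_
    exact ((zeroSumOn T).sub_mem hv hw).2
  have h1 := Submodule.finrank_mono (map_zeroSumOn_le_vectorSpan hF hx hxF hT)
  have h2 : Module.finrank ℝ ((zeroSumOn T).map (quotMap n)) = T.card - 1 := by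
    rw [← finrank_zeroSumOn T, ← LinearMap.range_domRestrict]
    exact LinearMap.finrank_range_of_inj (Set.injOn_iff_injective.1 hinj)
  omega

/-- Let `x` lie in the face and `y` in the hypersimplex over the same image. Then `y - x` can be
negative only where `x` is nonzero and positive only where `x` is not 1. As `x` has at most `i + 1`
fractional coordinates and sum `k`, both counts are too small unless `x = y`. -/
theorem isIPreserving_of_forall_mem_depSpace {π : QuotSpace n →ₗ[ℝ] (Fin d → ℝ)}
    (h : ∀ v ∈ depSpace π, v ≠ 0 → k + i < numNeg v ∨ n + i < numPos v + k) :
    IsIPreserving π k i := by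
  classical
  intro F hF hdim
  have hF' := hF
  rw [quotHypersimplex_eq_convexHull] at hF' ⊢
  refine strictlyPreserved_of_fiber_trivial ((finite_zeroOne n k).image _) hF' π ?_
  rw [← quotHypersimplex_eq_convexHull]
  intro x' hx' y' hy' hxy
  obtain ⟨x, hx, rfl⟩ := IsExposed.subset hF hx'
  obtain ⟨y, hy, rfl⟩ := hy'
  change quotMap n x ∈ F at hx'
  change π (quotMap n x) = π (quotMap n y) at hxy
  change quotMap n x = quotMap n y
  have hx0 := mem_hypersimplex.1 hx
  have hy0 := mem_hypersimplex.1 hy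
  by_contra hne
  have hv : y - x ∈ depSpace π := by
    rw [mem_depSpace, map_sub, map_sub, hxy, sub_self]
    simp [Finset.sum_sub_distrib, hx0.2, hy0.2]
  have hlt := h _ hv (fun h0 => hne (by rw [sub_eq_zero.1 h0]))
  set I : Finset (Fin n) := Finset.univ.filter fun j => x j = 1 with hI
  set J : Finset (Fin n) := Finset.univ.filter fun j => x j = 0 with hJ
  set T : Finset (Fin n) := Finset.univ.filter fun j => 0 < x j ∧ x j < 1 with hT
  have hTc := card_le_finrank_vectorSpan_add_one hF hx hx' (T := T) (by simp [hT])
  have hneg : numNeg (y - x) + J.card ≤ n := by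
    have hd : Disjoint (Finset.univ.filter fun j => (y - x) j < 0) J := by
      rw [Finset.disjoint_left]
      intro j h1 h2
      simp only [Finset.mem_filter, Finset.mem_univ, true_and, Pi.sub_apply, hJ] at h1 h2
      have := (hy0.1 j).1
      linarith
    rw [numNeg, ← Finset.card_union_of_disjoint hd]
    exact (Finset.card_le_univ _).trans (by simp)
  have hpos : numPos (y - x) + I.card ≤ n := by
    have hd : Disjoint (Finset.univ.filter fun j => 0 < (y - x) j) I := by
      rw [Finset.disjoint_left]
      intro j h1 h2
      simp only [Finset.mem_filter, Finset.mem_univ, true_and, Pi.sub_apply, hI] at h1 h2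
      have := (hy0.1 j).2
      linarith
    rw [numPos, ← Finset.card_union_of_disjoint hd]
    exact (Finset.card_le_univ _).trans (by simp)
  have hsplit : ∀ j, (1 : ℕ) = (if x j = 1 then 1 else 0) + (if x j = 0 then 1 else 0) +
      (if 0 < x j ∧ x j < 1 then 1 else 0) := by
    intro j
    by_cases h1 : x j = 1
    · simp [h1]
    by_cases h2 : x j = 0
    · simp [h2]
    have h3 : 0 < x j ∧ x j < 1 :=
      ⟨lt_of_le_of_ne (hx0.1 j).1 (Ne.symm h2), lt_of_le_of_ne (hx0.1 j).2 h1⟩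
    simp [h1, h2, h3]
  have hcard : I.card + J.card + T.card = n := by
    rw [hI, hJ, hT, Finset.card_filter, Finset.card_filter, Finset.card_filter,
      ← Finset.sum_add_distrib, ← Finset.sum_add_distrib,
      ← Finset.sum_congr rfl fun j _ => hsplit j]
    simp
  have hsum : (I.card : ℝ) + ∑ j ∈ T, x j = k := by
    rw [← hx0.2, hI, Finset.card_filter, hT, Finset.sum_filter]
    push_cast
    rw [← Finset.sum_add_distrib]
    refine Finset.sum_congr rfl fun j _ => ?_
    by_cases h1 : x j = 1
    · simp [h1]
    by_cases h2 : x j = 0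
    · simp [h2]
    have h3 : 0 < x j ∧ x j < 1 :=
      ⟨lt_of_le_of_ne (hx0.1 j).1 (Ne.symm h2), lt_of_le_of_ne (hx0.1 j).2 h1⟩
    simp [h1, h3]
  rcases T.eq_empty_or_nonempty with h0 | h0
  · rw [h0, Finset.sum_empty, add_zero] at hsum
    have : I.card = k := by exact_mod_cast hsum
    have : T.card = 0 := by simp [h0]
    omega
  · have h1 : 0 < ∑ j ∈ T, x j := Finset.sum_pos (fun j hj => by simp [hT] at hj; exact hj.1) h0
    have h2 : ∑ j ∈ T, x j < ∑ j ∈ T, (1 : ℝ) :=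
      Finset.sum_lt_sum_of_nonempty h0 (fun j hj => by simp [hT] at hj; exact hj.2)
    have h3 : (I.card : ℝ) < k := by linarith
    have h4 : (k : ℝ) < I.card + T.card := by
      simp only [Finset.sum_const, nsmul_eq_mul, mul_one] at h2
      linarith
    have h3' : I.card < k := by exact_mod_cast h3
    have h4' : k < I.card + T.card := by exact_mod_cast h4
    omega

theorem isIPreserving_iff (hk : 1 ≤ k) (hkn : k + 1 ≤ n)
    (π : QuotSpace n →ₗ[ℝ] (Fin d → ℝ)) :
    IsIPreserving π k i ↔
      ∀ v ∈ depSpace π, v ≠ 0 → k + i < numNeg v ∨ n + i < numPos v + k :=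
  ⟨fun h _ hv hv0 => lt_numNeg_or_lt_numPos_of_isIPreserving hk hkn h hv hv0,
    isIPreserving_of_forall_mem_depSpace⟩

end Criterion

/-! ### Neighborliness and dimension in terms of dependences. -/

section PointConfigurations

variable {n d : ℕ}

theorem pointConfig_eq (π : QuotSpace n →ₗ[ℝ] (Fin d → ℝ)) (j : Fin n) :
    pointConfig π j = π (quotMap n (Pi.single j 1)) := rfl

theorem map_quotMap_eq_sum (π : QuotSpace n →ₗ[ℝ] (Fin d → ℝ)) (x : Fin n → ℝ) :
    π (quotMap n x) = ∑ j, x j • pointConfig π j := by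
  conv_lhs => rw [← Finset.univ_sum_single x]
  simp only [map_sum, pointConfig_eq]
  refine Finset.sum_congr rfl fun j _ => ?_
  rw [← map_smul, ← map_smul, ← Pi.single_smul, smul_eq_mul, mul_one]

/-- A zero-sum dependence is orthogonal to the values of any affine functional on the points. -/
theorem sum_mul_sub_eq_zero {π : QuotSpace n →ₗ[ℝ] (Fin d → ℝ)} {v : Fin n → ℝ}
    (hv : v ∈ depSpace π) (l : StrongDual ℝ (Fin d → ℝ)) (M : ℝ) :
    ∑ j, v j * (l (pointConfig π j) - M) = 0 := by
  rw [mem_depSpace, map_quotMap_eq_sum] at hv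
  have h := congrArg l hv.2
  simp only [map_sum, map_smul, smul_eq_mul, map_zero] at h
  simp [mul_sub, Finset.sum_sub_distrib, h, ← Finset.sum_mul, hv.1]

@[simp] theorem numNeg_neg (v : Fin n → ℝ) : numNeg (-v) = numPos v := by
  simp [numNeg, numPos]

@[simp] theorem numPos_neg (v : Fin n → ℝ) : numPos (-v) = numNeg v := by
  simp [numNeg, numPos]

theorem numPos_smul {c : ℝ} (hc : 0 < c) (v : Fin n → ℝ) : numPos (c • v) = numPos v := by
  simp [numPos, hc]

theorem numNeg_smul_of_neg {c : ℝ} (hc : c < 0) (v : Fin n → ℝ) :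
    numNeg (c • v) = numPos v := by
  have : c • v = -((-c) • v) := by simp
  rw [this, numNeg_neg, numPos_smul (by linarith)]

theorem numPos_add_numNeg_le (v : Fin n → ℝ) : numPos v + numNeg v ≤ n := by
  classical
  rw [numPos, numNeg, ← Finset.card_union_of_disjoint]
  · exact (Finset.card_le_univ _).trans (by simp)
  · rw [Finset.disjoint_left]
    intro j h1 h2
    simp only [Finset.mem_filter, Finset.mem_univ, true_and] at h1 h2
    linarith

theorem numNeg_pos_of_sum_eq_zero {v : Fin n → ℝ} (hv : v ≠ 0) (hs : ∑ j, v j = 0) :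
    0 < numNeg v := by
  obtain ⟨j, hj⟩ := exists_neg_of_sum_eq_zero hv hs
  exact Finset.card_pos.2 ⟨j, by simpa using hj⟩

theorem hypersimplex_one_eq_stdSimplex (n : ℕ) : hypersimplex n 1 = stdSimplex ℝ (Fin n) := by
  ext x
  rw [mem_hypersimplex, Nat.cast_one]
  constructor
  · rintro ⟨h, hs⟩
    exact ⟨fun j => (h j).1, hs⟩
  · rintro ⟨h, hs⟩
    exact ⟨fun j => ⟨h j, hs ▸ Finset.single_le_sum (fun j _ => h j) (Finset.mem_univ j)⟩, hs⟩

theorem single_mem_hypersimplex_one (j : Fin n) : Pi.single j 1 ∈ hypersimplex n 1 := by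
  rw [hypersimplex_one_eq_stdSimplex]
  exact single_mem_stdSimplex ℝ j

theorem quotHypersimplex_one_eq (n : ℕ) : quotHypersimplex n 1 =
    convexHull ℝ (Set.range fun j : Fin n => quotMap n (Pi.single j 1)) := by
  classical
  have : (Set.range fun j : Fin n => quotMap n (Pi.single j 1)) =
      quotMap n '' (Set.range fun j : Fin n => (Pi.single j 1 : Fin n → ℝ)) := by
    rw [← Set.range_comp]; rfl
  rw [this, ← LinearMap.image_convexHull, quotHypersimplex_eq_image,
    hypersimplex_one_eq_stdSimplex, ← convexHull_rangle_single_eq_stdSimplex]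

theorem image_quotHypersimplex_one (π : QuotSpace n →ₗ[ℝ] (Fin d → ℝ)) :
    π '' quotHypersimplex n 1 = convexHull ℝ (Set.range (pointConfig π)) := by
  rw [quotHypersimplex_one_eq, LinearMap.image_convexHull, ← Set.range_comp]
  rfl

/-- For `k = 1` the hypersimplex is a simplex. A difference `y - x` with `x` supported on `A` has
its negative coordinates in `A`, so there are too few of them. -/
theorem fiber_trivial_quotFace_one {π : QuotSpace n →ₗ[ℝ] (Fin d → ℝ)} {m : ℕ}
    (h : ∀ v ∈ depSpace π, v ≠ 0 → m < numNeg v) {A : Finset (Fin n)} (hA : A.card ≤ m) :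
    ∀ x ∈ quotFace n 1 ∅ Aᶜ, ∀ y ∈ quotHypersimplex n 1, π x = π y → x = y := by
  rintro _ ⟨x, ⟨hx, -, hxA⟩, rfl⟩ _ ⟨y, hy, rfl⟩ hxy
  change π (quotMap n x) = π (quotMap n y) at hxy
  change quotMap n x = quotMap n y
  have hx0 := mem_hypersimplex.1 hx
  have hy0 := mem_hypersimplex.1 hy
  by_contra hne
  have hv : y - x ∈ depSpace π := by
    rw [mem_depSpace, map_sub, map_sub, hxy, sub_self]
    simp [Finset.sum_sub_distrib, hx0.2, hy0.2]
  have hlt := h _ hv (fun h0 => hne (by rw [sub_eq_zero.1 h0]))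
  refine absurd (hlt.trans_le (Finset.card_le_card (t := A) fun j hj => ?_)) (not_lt.2 hA)
  simp only [Finset.mem_filter, Finset.mem_univ, true_and, Pi.sub_apply] at hj
  by_contra hjA
  have h1 := hxA j (Finset.mem_compl.2 hjA)
  have h2 := (hy0.1 j).1
  linarith

theorem isFace_image_quotFace_one (hn : 0 < n) {π : QuotSpace n →ₗ[ℝ] (Fin d → ℝ)} {m : ℕ}
    (h : ∀ v ∈ depSpace π, v ≠ 0 → m < numNeg v) {A : Finset (Fin n)} (hA : A.card ≤ m) :
    IsFace (convexHull ℝ (Set.range (pointConfig π))) (π '' quotFace n 1 ∅ Aᶜ) := by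
  have hF := isFace_quotFace (k := 1) hn ∅ Aᶜ
  have hfib := fiber_trivial_quotFace_one h hA
  rw [← image_quotHypersimplex_one]
  rw [quotHypersimplex_one_eq] at hF hfib ⊢
  exact isFace_image_of_fiber_trivial (Set.finite_range _) hF π hfib

theorem image_quotFace_one_eq (π : QuotSpace n →ₗ[ℝ] (Fin d → ℝ)) (A : Finset (Fin n)) :
    π '' quotFace n 1 ∅ Aᶜ = convexHull ℝ (pointConfig π '' (A : Set (Fin n))) := by
  apply subset_antisymm
  · rintro _ ⟨_, ⟨x, ⟨hx, -, hxA⟩, rfl⟩, rfl⟩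
    have hx0 := mem_hypersimplex.1 hx
    have h0 : ∀ j ∉ A, x j = 0 := fun j hj => hxA j (Finset.mem_compl.2 hj)
    rw [map_quotMap_eq_sum, ← Finset.sum_subset (Finset.subset_univ A)
      (fun j _ hj => by rw [h0 j hj, zero_smul])]
    refine (convex_convexHull ℝ _).sum_mem (fun j _ => (hx0.1 j).1) ?_
      fun j hj => subset_convexHull ℝ _ ⟨j, hj, rfl⟩
    rw [Finset.sum_subset (Finset.subset_univ A) fun j _ hj => h0 j hj, hx0.2, Nat.cast_one]
  · have hc : Convex ℝ (π '' quotFace n 1 ∅ Aᶜ) := by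
      refine Convex.linear_image (Convex.linear_image ?_ _) π
      rintro x ⟨hx, -, hxA⟩ y ⟨hy, -, hyA⟩ a b ha hb hab
      refine ⟨convex_convexHull ℝ _ hx hy ha hb hab, by simp, fun j hj => ?_⟩
      simp [hxA j hj, hyA j hj]
    refine convexHull_min ?_ hc
    rintro _ ⟨j, hj, rfl⟩
    refine ⟨_, ⟨Pi.single j 1, ⟨single_mem_hypersimplex_one j, by simp, fun a ha => ?_⟩, rfl⟩, rfl⟩
    refine Pi.single_eq_of_ne ?_ _
    rintro rfl
    exact Finset.mem_compl.1 ha hj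

/-- For necessity, take the face spanned by the points with negative coefficient. Pairing the
dependence with its functional forces the points with positive coefficient onto the same face. For
sufficiency, faces of the simplex are carried over injectively. -/
theorem isNeighborly_iff (hn : 0 < n) (π : QuotSpace n →ₗ[ℝ] (Fin d → ℝ)) (m : ℕ) :
    IsNeighborly (pointConfig π) m ↔ ∀ v ∈ depSpace π, v ≠ 0 → m < numNeg v := by
  constructor
  · intro h v hv hv0
    by_contra hle
    push Not at hle
    obtain ⟨F, hF, hext, hmem⟩ := h (Finset.univ.filter fun j => v j < 0) hle
    have hs := (mem_depSpace.1 hv).1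
    obtain ⟨a, ha⟩ := exists_pos_of_sum_eq_zero hv0 hs
    obtain ⟨b, hb⟩ := exists_neg_of_sum_eq_zero hv0 hs
    have hNF : ∀ j, v j < 0 → pointConfig π j ∈ F := by
      intro j hj
      have : pointConfig π j ∈ F.extremePoints ℝ := by
        rw [hext]
        exact ⟨j, by simpa using hj, rfl⟩
      exact extremePoints_subset this
    obtain ⟨l, hl⟩ := hF ⟨_, hNF b hb⟩
    have hbF := hNF b hb
    rw [hl] at hbF
    have hle : ∀ j, l (pointConfig π j) ≤ l (pointConfig π b) := fun j =>
      hbF.2 _ (subset_convexHull ℝ _ ⟨j, rfl⟩)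
    have hterm : ∀ j ∈ Finset.univ,
        v j * (l (pointConfig π j) - l (pointConfig π b)) ≤ 0 := by
      intro j _
      rcases lt_or_ge (v j) 0 with hj | hj
      · have hjF := hNF j hj
        rw [hl] at hjF
        have := hjF.2 _ hbF.1
        rw [le_antisymm (hle j) this, sub_self, mul_zero]
      · exact mul_nonpos_of_nonneg_of_nonpos hj (by linarith [hle j])
    have hz := (Finset.sum_eq_zero_iff_of_nonpos hterm).1
      (sum_mul_sub_eq_zero hv l _) a (Finset.mem_univ a)
    have hla : l (pointConfig π a) = l (pointConfig π b) := by
      rcases mul_eq_zero.1 hz with h | h <;> linarith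
    have haF : pointConfig π a ∈ F := by
      rw [hl]
      refine ⟨subset_convexHull ℝ _ ⟨a, rfl⟩, ?_⟩
      rw [hla]
      exact hbF.2
    have := hmem a haF
    simp only [Finset.mem_filter, Finset.mem_univ, true_and] at this
    linarith
  · intro h A hA
    have hface := isFace_image_quotFace_one hn h hA
    refine ⟨_, hface, ?_, ?_⟩
    · apply subset_antisymm
      · rw [image_quotFace_one_eq]
        exact extremePoints_convexHull_subset
      · rintro _ ⟨a, ha, rfl⟩
        -- The singleton is within the allowed size too, so each point of `A` is itself a vertex of
        -- the whole hull.
        have h1 := isFace_image_quotFace_one hn h (A := {a}) ((by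
          rw [Finset.card_singleton]
          exact Finset.card_pos.2 ⟨a, ha⟩ : _ ≤ A.card).trans hA)
        rw [image_quotFace_one_eq, Finset.coe_singleton, Set.image_singleton,
          convexHull_singleton] at h1
        refine inter_extremePoints_subset_extremePoints_of_subset (IsExposed.subset hface)
          ⟨?_, isExtreme_singleton.1 (IsExposed.isExtreme h1)⟩
        rw [image_quotFace_one_eq]
        exact subset_convexHull ℝ _ ⟨a, ha, rfl⟩
    · rintro j ⟨_, hxF, hxj⟩
      have hj := fiber_trivial_quotFace_one h hA _ hxF _
        ⟨Pi.single j 1, single_mem_hypersimplex_one j, rfl⟩ hxj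
      obtain ⟨x, ⟨hx, -, hxA⟩, rfl⟩ := hxF
      have := eq_of_quotMap_eq hx (single_mem_hypersimplex_one j) hj
      by_contra hjA
      have h0 := hxA j (Finset.mem_compl.2 hjA)
      rw [this] at h0
      simp at h0

theorem exists_sum_eq_and_map_eq (hn : 0 < n) {π : QuotSpace n →ₗ[ℝ] (Fin d → ℝ)}
    (hπ : Function.Surjective π) (s : ℝ) (y : Fin d → ℝ) :
    ∃ x : Fin n → ℝ, ∑ j, x j = s ∧ π (quotMap n x) = y := by
  obtain ⟨z, rfl⟩ := hπ y
  obtain ⟨x, rfl⟩ := quotMap_surjective n z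
  have hn' : (n : ℝ) ≠ 0 := by positivity
  refine ⟨x + ((s - ∑ j, x j) / n) • (fun _ => 1), ?_, ?_⟩
  · simp only [Pi.add_apply, Pi.smul_apply, smul_eq_mul, mul_one, Finset.sum_add_distrib,
      Finset.sum_const, Finset.card_univ, Fintype.card_fin, nsmul_eq_mul]
    field_simp
    ring
  · rw [map_add, map_smul, quotMap_one, smul_zero, add_zero]

theorem finrank_depSpace (hn : 0 < n) {π : QuotSpace n →ₗ[ℝ] (Fin d → ℝ)}
    (hπ : Function.Surjective π) : Module.finrank ℝ (depSpace π) + d + 1 = n := by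
  have hs : Function.Surjective ((coordSum (Fin n)).prod (π ∘ₗ quotMap n)) := by
    rintro ⟨s, y⟩
    obtain ⟨x, h1, h2⟩ := exists_sum_eq_and_map_eq hn hπ s y
    exact ⟨x, Prod.ext (by simpa using h1) h2⟩
  have := LinearMap.finrank_range_add_finrank_ker ((coordSum (Fin n)).prod (π ∘ₗ quotMap n))
  rw [LinearMap.range_eq_top.2 hs, LinearMap.ker_prod, finrank_top] at this
  simp only [Module.finrank_prod, Module.finrank_self, Module.finrank_fintype_fun_eq_card,
    Fintype.card_fin] at this
  change 1 + d + Module.finrank ℝ (depSpace π) = n at this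
  omega

theorem affineSpan_range_pointConfig (hn : 0 < n) {π : QuotSpace n →ₗ[ℝ] (Fin d → ℝ)}
    (hπ : Function.Surjective π) : affineSpan ℝ (Set.range (pointConfig π)) = ⊤ := by
  rw [eq_top_iff]
  rintro y -
  obtain ⟨x, h1, rfl⟩ := exists_sum_eq_and_map_eq hn hπ 1 y
  rw [map_quotMap_eq_sum, ← Finset.affineCombination_eq_linear_combination _ _ _ h1]
  exact affineCombination_mem_affineSpan h1 _

theorem finrank_vectorSpan_range_pointConfig (hn : 0 < n) {π : QuotSpace n →ₗ[ℝ] (Fin d → ℝ)}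
    (hπ : Function.Surjective π) :
    Module.finrank ℝ (vectorSpan ℝ (Set.range (pointConfig π))) = d := by
  rw [← direction_affineSpan, affineSpan_range_pointConfig hn hπ, AffineSubspace.direction_top,
    finrank_top, Module.finrank_fintype_fun_eq_card, Fintype.card_fin]

theorem finrank_quotSpace (hn : 0 < n) : Module.finrank ℝ (QuotSpace n) + 1 = n := by
  have := Submodule.finrank_quotient_add_finrank
    (Submodule.span ℝ {(fun _ => 1 : Fin n → ℝ)})
  rw [finrank_span_singleton, Module.finrank_fintype_fun_eq_card, Fintype.card_fin] at this
  · exact this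
  · intro h
    have := congrFun h ⟨0, hn⟩
    simp at this

theorem bijective_iff_finrank_depSpace_eq_zero (hn : 0 < n) {π : QuotSpace n →ₗ[ℝ] (Fin d → ℝ)}
    (hπ : Function.Surjective π) :
    Function.Bijective π ↔ Module.finrank ℝ (depSpace π) = 0 := by
  have hq := finrank_quotSpace hn
  have hd := finrank_depSpace hn hπ
  constructor
  · intro h
    have := (LinearEquiv.ofBijective π h).finrank_eq
    rw [Module.finrank_fintype_fun_eq_card, Fintype.card_fin] at this
    omega
  · intro h
    refine ⟨?_, hπ⟩
    refine (LinearMap.injective_iff_surjective_of_finrank_eq_finrank ?_).2 hπ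
    rw [Module.finrank_fintype_fun_eq_card, Fintype.card_fin]
    omega

end PointConfigurations

/-! ### Almost neighborliness in terms of dependences. -/

section AlmostNeighborly

variable {n d : ℕ}

theorem card_filter_not_pos (v : Fin n → ℝ) :
    (Finset.univ.filter fun j => ¬ 0 < v j).card + numPos v = n := by
  have := Finset.card_filter_add_card_filter_not (s := (Finset.univ : Finset (Fin n)))
    (fun j => 0 < v j)
  rw [Finset.card_univ, Fintype.card_fin] at this
  rw [numPos]
  omega

/-- The labelled points sum to 0. Push the barycenter `c` of `A` slightly away from 0, to `(1 + ε) •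
c`, staying in the hull, and compare two expressions for the result; adding `ε / n` times the
all-ones vector balances the sum and makes the coefficients off `A` strictly positive. -/
theorem exists_mem_depSpace_of_mem_interior (hn : 0 < n) {π : QuotSpace n →ₗ[ℝ] (Fin d → ℝ)}
    {A : Finset (Fin n)} (hA : A.Nonempty)
    (hint : (A.card : ℝ)⁻¹ • ∑ j ∈ A, pointConfig π j ∈
      interior (convexHull ℝ (Set.range (pointConfig π)))) :
    ∃ v ∈ depSpace π, ∀ j ∉ A, 0 < v j := by
  classical
  set c := (A.card : ℝ)⁻¹ • ∑ j ∈ A, pointConfig π j with hc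
  have hApos : (A.card : ℝ) ≠ 0 := by exact_mod_cast hA.card_pos.ne'
  have hev : ∀ᶠ ε : ℝ in nhdsWithin 0 (Set.Ioi 0),
      (1 + ε) • c ∈ convexHull ℝ (Set.range (pointConfig π)) := by
    have hcont : Continuous fun ε : ℝ => (1 + ε) • c := by fun_prop
    have ht : Filter.Tendsto (fun ε : ℝ => (1 + ε) • c) (nhdsWithin 0 (Set.Ioi 0)) (nhds c) := by
      simpa using (hcont.tendsto 0).mono_left nhdsWithin_le_nhds
    exact ht.eventually (mem_interior_iff_mem_nhds.1 hint)
  obtain ⟨ε, hmem, hε⟩ := (hev.and self_mem_nhdsWithin).exists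
  have hε : 0 < ε := hε
  rw [← image_quotHypersimplex_one] at hmem
  obtain ⟨_, ⟨y, hy, rfl⟩, hyc⟩ := hmem
  change π (quotMap n y) = _ at hyc
  have hy0 := mem_hypersimplex.1 hy
  have hn' : (n : ℝ) ≠ 0 := by positivity
  let u : Fin n → ℝ := fun j => if j ∈ A then (A.card : ℝ)⁻¹ else 0
  have hu : ∑ j, u j = 1 := by simp [u, hApos]
  have huc : π (quotMap n u) = c := by
    rw [map_quotMap_eq_sum, hc, Finset.smul_sum]
    simp [u, ite_smul]
  refine ⟨y + (ε / n) • (fun _ => 1) - (1 + ε) • u, ?_, ?_⟩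
  · rw [mem_depSpace]
    constructor
    · simp only [Pi.sub_apply, Pi.add_apply, Pi.smul_apply, smul_eq_mul, mul_one,
        Finset.sum_sub_distrib, Finset.sum_add_distrib, hy0.2, ← Finset.mul_sum, hu,
        Finset.sum_const, Finset.card_univ, Fintype.card_fin, nsmul_eq_mul]
      field_simp
      simp
    · rw [map_sub, map_add, map_smul, map_smul, quotMap_one, smul_zero, add_zero, map_sub,
        map_smul, hyc, huc, sub_self]
  · intro j hj
    have h1 := (hy0.1 j).1
    have h2 : 0 < ε / n := by positivity
    simp only [Pi.sub_apply, Pi.add_apply, Pi.smul_apply, smul_eq_mul, mul_one, u, hj, if_false]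
    linarith

/-- A supporting hyperplane at the barycenter of `A` contains all of `A`, since an average attains
the maximum only if each term does. It misses the interior, so the face is proper. -/
theorem exists_proper_face_of_notMem_interior (hn : 0 < n)
    {π : QuotSpace n →ₗ[ℝ] (Fin d → ℝ)} (hπ : Function.Surjective π)
    {A : Finset (Fin n)} (hA : A.Nonempty)
    (hint : (A.card : ℝ)⁻¹ • ∑ j ∈ A, pointConfig π j ∉
      interior (convexHull ℝ (Set.range (pointConfig π)))) :
    ∃ F, IsFace (convexHull ℝ (Set.range (pointConfig π))) F ∧
      F ≠ convexHull ℝ (Set.range (pointConfig π)) ∧ ∀ m ∈ A, pointConfig π m ∈ F := by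
  set S := convexHull ℝ (Set.range (pointConfig π)) with hS
  have hSc : Convex ℝ S := convex_convexHull ℝ _
  have hApos : (0 : ℝ) < A.card := by exact_mod_cast hA.card_pos
  obtain ⟨l, hl⟩ := geometric_hahn_banach_open_point hSc.interior isOpen_interior hint
  set c := (A.card : ℝ)⁻¹ • ∑ j ∈ A, pointConfig π j with hc
  have hne : (interior S).Nonempty :=
    interior_convexHull_nonempty_iff_affineSpan_eq_top.2 (affineSpan_range_pointConfig hn hπ)
  have hle : ∀ y ∈ S, l y ≤ l c := by
    intro y hy
    have hy' : y ∈ closure (interior S) := by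
      rw [hSc.closure_interior_eq_closure_of_nonempty_interior hne]
      exact subset_closure hy
    exact closure_minimal (t := {y | l y ≤ l c}) (fun z hz => (hl z hz).le)
      (isClosed_le l.continuous continuous_const) hy'
  have hAS : ∀ j, pointConfig π j ∈ S := fun j => subset_convexHull ℝ _ ⟨j, rfl⟩
  have hsum : ∑ j ∈ A, (l c - l (pointConfig π j)) = 0 := by
    rw [Finset.sum_sub_distrib, Finset.sum_const, nsmul_eq_mul, hc, map_smul, map_sum,
      smul_eq_mul, mul_inv_cancel_left₀ hApos.ne', sub_self]
  have hAeq := (Finset.sum_eq_zero_iff_of_nonneg fun j _ =>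
    sub_nonneg.2 (hle _ (hAS j))).1 hsum
  obtain ⟨a, ha⟩ := hA
  have hla : ∀ j ∈ A, l (pointConfig π j) = l c := fun j hj => by linarith [hAeq j hj]
  refine ⟨{x ∈ S | ∀ y ∈ S, l y ≤ l x}, fun _ => ⟨l, rfl⟩, ?_, ?_⟩
  · intro h
    obtain ⟨z, hz⟩ := hne
    have hz' := interior_subset hz
    rw [← h] at hz'
    have h1 := hz'.2 _ (hAS a)
    have h2 := hl z hz
    have h3 := hla a ha
    linarith
  · intro j hj
    refine ⟨hAS j, ?_⟩
    rw [hla j hj]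
    exact hle

theorem not_isAlmostNeighborly_iff (hn : 0 < n) {π : QuotSpace n →ₗ[ℝ] (Fin d → ℝ)}
    (hπ : Function.Surjective π) (m : ℤ) :
    ¬ IsAlmostNeighborly (pointConfig π) m ↔ ∃ v ∈ depSpace π, (n : ℤ) ≤ numPos v + m := by
  have hSne : (convexHull ℝ (Set.range (pointConfig π))).Nonempty :=
    ⟨_, subset_convexHull ℝ _ ⟨⟨0, hn⟩, rfl⟩⟩
  constructor
  · intro h
    rw [IsAlmostNeighborly] at h
    push Not at h
    obtain ⟨A, hAm, hA⟩ := h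
    have hAne : A.Nonempty := by
      by_contra hne
      rw [Finset.not_nonempty_iff_eq_empty] at hne
      obtain ⟨j, hj, -⟩ := hA ∅ (fun h => absurd h Set.not_nonempty_empty) hSne.ne_empty.symm
      simp [hne] at hj
    have hint : (A.card : ℝ)⁻¹ • ∑ j ∈ A, pointConfig π j ∈
        interior (convexHull ℝ (Set.range (pointConfig π))) := by
      by_contra hint
      obtain ⟨F, hF, hFne, hFA⟩ := exists_proper_face_of_notMem_interior hn hπ hAne hint
      obtain ⟨j, hj, hjF⟩ := hA F hF hFne
      exact hjF (hFA j hj)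
    obtain ⟨v, hv, hvA⟩ := exists_mem_depSpace_of_mem_interior hn hAne hint
    refine ⟨v, hv, ?_⟩
    have h1 := card_filter_not_pos v
    have h2 : (Finset.univ.filter fun j => ¬ 0 < v j).card ≤ A.card := by
      refine Finset.card_le_card fun j hj => ?_
      simp only [Finset.mem_filter, Finset.mem_univ, true_and] at hj
      by_contra hjA
      exact hj (hvA j hjA)
    omega
  · rintro ⟨v, hv, hvm⟩ h
    have h1 := card_filter_not_pos v
    -- A face through all points with nonpositive coefficient must, by orthogonality, contain the
    -- remaining points too, so it is not proper.
    obtain ⟨F, hF, hFne, hFA⟩ := h (Finset.univ.filter fun j => ¬ 0 < v j) (by omega)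
    have hFA' : ∀ j, v j ≤ 0 → pointConfig π j ∈ F := fun j hj => hFA j (by simpa using hj)
    obtain ⟨b, hb⟩ : ∃ b, v b ≤ 0 := by
      by_contra hc
      push Not at hc
      have : 0 < ∑ j, v j := Finset.sum_pos (fun j _ => hc j) ⟨⟨0, hn⟩, Finset.mem_univ _⟩
      rw [(mem_depSpace.1 hv).1] at this
      exact lt_irrefl _ this
    obtain ⟨l, hl⟩ := hF ⟨_, hFA' b hb⟩
    have hbF := hFA' b hb
    rw [hl] at hbF
    have hle : ∀ j, l (pointConfig π j) ≤ l (pointConfig π b) := fun j =>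
      hbF.2 _ (subset_convexHull ℝ _ ⟨j, rfl⟩)
    have heq : ∀ j, v j ≤ 0 → l (pointConfig π j) = l (pointConfig π b) := by
      intro j hj
      have hjF := hFA' j hj
      rw [hl] at hjF
      exact le_antisymm (hle j) (hjF.2 _ hbF.1)
    have hterm : ∀ j ∈ Finset.univ,
        v j * (l (pointConfig π j) - l (pointConfig π b)) ≤ 0 := by
      intro j _
      rcases le_or_gt (v j) 0 with hj | hj
      · rw [heq j hj, sub_self, mul_zero]
      · exact mul_nonpos_of_nonneg_of_nonpos hj.le (by linarith [hle j])
    have hz := (Finset.sum_eq_zero_iff_of_nonpos hterm).1 (sum_mul_sub_eq_zero hv l _)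
    have hall : ∀ j, pointConfig π j ∈ F := by
      intro j
      rcases le_or_gt (v j) 0 with hj | hj
      · exact hFA' j hj
      · have hlj : l (pointConfig π j) = l (pointConfig π b) := by
          rcases mul_eq_zero.1 (hz j (Finset.mem_univ j)) with h | h <;> linarith
        rw [hl]
        refine ⟨subset_convexHull ℝ _ ⟨j, rfl⟩, ?_⟩
        rw [hlj]
        exact hbF.2
    refine hFne (subset_antisymm (IsExposed.subset hF) (convexHull_min ?_
      (IsExposed.convex hF (convex_convexHull ℝ _))))
    rintro _ ⟨j, rfl⟩
    exact hall j

end AlmostNeighborly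

/-! ### The three alternatives, by the dimension of the dependences. -/

section Classification

variable {n d k i : ℕ}

theorem isOpen_lt_numPos (m : ℕ) : IsOpen {x : Fin n → ℝ | m < numPos x} := by
  rw [isOpen_iff_eventually]
  intro x hx
  have : ∀ᶠ y in nhds x, ∀ j, 0 < x j → 0 < y j := by
    rw [Filter.eventually_all]
    intro j
    by_cases hj : 0 < x j
    · have := (continuous_apply j).tendsto x |>.eventually (lt_mem_nhds hj)
      exact this.mono fun y hy _ => hy
    · exact Filter.Eventually.of_forall fun y h => absurd h hj
  filter_upwards [this] with y hy
  refine lt_of_lt_of_le (show m < numPos x from hx) (Finset.card_le_card fun j hj => ?_)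
  simp only [Finset.mem_filter, Finset.mem_univ, true_and] at hj ⊢
  exact hy j hj

theorem isOpen_lt_numNeg (m : ℕ) : IsOpen {x : Fin n → ℝ | m < numNeg x} := by
  have := (isOpen_lt_numPos (n := n) m).preimage continuous_neg
  simpa [Set.preimage] using this

/-- Applying the hypothesis to `x` and `-x` covers the connected set of nonzero vectors by two open
sets: mostly positive (`U`), and mostly negative or balanced (`W`). They are disjoint because at
most `n` coordinates are nonzero and `2 * k ≤ n`. If `v` violated the claim, `v` would lie in `U`
and `-v` in `W`. -/
theorem lt_numNeg_of_two_le_finrank {K : Submodule ℝ (Fin n → ℝ)} (hkn : 2 * k ≤ n)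
    (hK : 2 ≤ Module.finrank ℝ K)
    (h : ∀ v ∈ K, v ≠ 0 → k + i < numNeg v ∨ n + i < numPos v + k) :
    ∀ v ∈ K, v ≠ 0 → k + i < numNeg v := by
  intro v hv hv0
  by_contra hq
  have hp := (h v hv hv0).resolve_left hq
  have hconn : IsPreconnected ({0}ᶜ : Set K) :=
    (isConnected_compl_singleton_of_one_lt_rank (by
      rw [← Module.finrank_eq_rank]
      exact_mod_cast hK) 0).isPreconnected
  let U : Set K := {x | n + i - k < numPos (x : Fin n → ℝ)}
  let W : Set K := {x | n + i - k < numNeg (x : Fin n → ℝ)} ∪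
    ({x | k + i < numPos (x : Fin n → ℝ)} ∩ {x | k + i < numNeg (x : Fin n → ℝ)})
  have hU : IsOpen U := (isOpen_lt_numPos _).preimage continuous_subtype_val
  have hW : IsOpen W := ((isOpen_lt_numNeg _).preimage continuous_subtype_val).union
    (((isOpen_lt_numPos _).preimage continuous_subtype_val).inter
      ((isOpen_lt_numNeg _).preimage continuous_subtype_val))
  have hcov : ({0}ᶜ : Set K) ⊆ U ∪ W := by
    intro x hx
    have hx0 : (x : Fin n → ℝ) ≠ 0 := fun h0 => hx (Subtype.ext h0)
    have h1 := h x x.2 hx0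
    have h2 := h (-x) (K.neg_mem x.2) (neg_ne_zero.2 hx0)
    rw [numNeg_neg, numPos_neg] at h2
    by_cases h3 : n + i - k < numPos (x : Fin n → ℝ)
    · exact Or.inl h3
    by_cases h4 : n + i - k < numNeg (x : Fin n → ℝ)
    · exact Or.inr (Or.inl h4)
    refine Or.inr (Or.inr ⟨?_, ?_⟩)
    · change k + i < numPos (x : Fin n → ℝ)
      omega
    · change k + i < numNeg (x : Fin n → ℝ)
      omega
  obtain ⟨x, -, hxU, hxW⟩ := hconn U W hU hW hcov
    ⟨⟨v, hv⟩, fun h0 => hv0 (congrArg Subtype.val h0), by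
      change n + i - k < numPos v
      omega⟩
    ⟨⟨-v, K.neg_mem hv⟩, fun h0 => hv0 (neg_eq_zero.1 (congrArg Subtype.val h0)), by
      refine Or.inl ?_
      change n + i - k < numNeg (-v)
      rw [numNeg_neg]
      omega⟩
  have hle := numPos_add_numNeg_le (x : Fin n → ℝ)
  change n + i - k < numPos (x : Fin n → ℝ) at hxU
  rcases hxW with hxW | ⟨-, hxW⟩
  · change n + i - k < numNeg (x : Fin n → ℝ) at hxW
    omega
  · change k + i < numNeg (x : Fin n → ℝ) at hxW
    omega

theorem lt_or_lt_of_mem_span_singleton (hkn : 2 * k ≤ n) {w v : Fin n → ℝ}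
    (hw : n + i < numPos w + k) (hv : v ∈ Submodule.span ℝ {w}) (hv0 : v ≠ 0) :
    k + i < numNeg v ∨ n + i < numPos v + k := by
  obtain ⟨c, rfl⟩ := Submodule.mem_span_singleton.1 hv
  rcases lt_trichotomy c 0 with hc | rfl | hc
  · left
    rw [numNeg_smul_of_neg hc]
    omega
  · simp at hv0
  · right
    rwa [numPos_smul hc]

theorem isIPreserving_iff_neighborly (hk : 1 ≤ k) (hkn : 2 * k ≤ n)
    {π : QuotSpace n →ₗ[ℝ] (Fin d → ℝ)} (hπ : Function.Surjective π) :
    IsIPreserving π k i ↔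
      (IsNeighborly (pointConfig π) (k + i) ∨
        (Module.finrank ℝ (vectorSpan ℝ (Set.range (pointConfig π))) = n - 2 ∧
          ¬ IsAlmostNeighborly (pointConfig π) ((k : ℤ) - (i : ℤ) - 1)) ∨
        Function.Bijective π) := by
  have hn : 0 < n := by omega
  have hd := finrank_depSpace hn hπ
  rw [isIPreserving_iff hk (by omega), isNeighborly_iff hn,
    finrank_vectorSpan_range_pointConfig hn hπ, not_isAlmostNeighborly_iff hn hπ,
    bijective_iff_finrank_depSpace_eq_zero hn hπ]
  constructor
  · intro h
    by_cases h0 : Module.finrank ℝ (depSpace π) = 0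
    · exact Or.inr (Or.inr h0)
    by_cases h1 : Module.finrank ℝ (depSpace π) = 1
    · by_cases hq : ∀ v ∈ depSpace π, v ≠ 0 → k + i < numNeg v
      · exact Or.inl hq
      · push Not at hq
        obtain ⟨v, hv, hv0, hq⟩ := hq
        have := h v hv hv0
        exact Or.inr (Or.inl ⟨by omega, v, hv, by omega⟩)
    · exact Or.inl (lt_numNeg_of_two_le_finrank hkn (by omega) h)
  · rintro (h | ⟨h, w, hw, hp⟩ | h) v hv hv0
    · exact Or.inl (h v hv hv0)
    · have hw0 : (⟨w, hw⟩ : depSpace π) ≠ 0 := by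
        intro h0
        have : w = 0 := congrArg Subtype.val h0
        simp only [this, numPos, Pi.zero_apply, lt_irrefl, Finset.filter_false,
          Finset.card_empty] at hp
        omega
      have h1 : Module.finrank ℝ (depSpace π) = 1 := by omega
      obtain ⟨c, hc⟩ := (finrank_eq_one_iff_of_nonzero' _ hw0).1 h1 ⟨v, hv⟩
      exact lt_or_lt_of_mem_span_singleton hkn (w := w) (by omega)
        (Submodule.mem_span_singleton.2 ⟨c, congrArg Subtype.val hc⟩) hv0
    · rw [Submodule.finrank_eq_zero] at h
      rw [h] at hv
      exact absurd hv hv0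

end Classification

/-! ### Dimensions in which preserving maps exist. -/

section Existence

variable {n d k i : ℕ}

theorem Submodule.exists_le_finrank_eq {V : Type*} [AddCommGroup V] [Module ℝ V]
    (K : Submodule ℝ V) [FiniteDimensional ℝ K] {m : ℕ} (hm : m ≤ Module.finrank ℝ K) :
    ∃ K' ≤ K, Module.finrank ℝ K' = m := by
  let b := Module.finBasis ℝ K
  let f : Fin m → V := fun j => (b (Fin.castLE hm j) : V)
  have hf : LinearIndependent ℝ f :=
    (b.linearIndependent.map' K.subtype K.ker_subtype).comp _ (Fin.castLE_injective hm)
  refine ⟨Submodule.span ℝ (Set.range f), ?_, ?_⟩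
  · rw [Submodule.span_le]
    rintro _ ⟨j, rfl⟩
    exact (b _).2
  · rw [finrank_span_eq_card hf, Fintype.card_fin]

/-- Quotient by the image of an `(n - 1 - d)`-dimensional subspace of `K`; the zero-sum condition
makes the quotient map injective on it. -/
theorem exists_surjective_depSpace_le (hd : d + 1 ≤ n) (K : Submodule ℝ (Fin n → ℝ))
    (hK : ∀ v ∈ K, ∑ j, v j = 0) (hfin : n ≤ Module.finrank ℝ K + d + 1) :
    ∃ π : QuotSpace n →ₗ[ℝ] (Fin d → ℝ), Function.Surjective π ∧ depSpace π ≤ K := by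
  have hn : 0 < n := by omega
  obtain ⟨K', hK', hfin'⟩ := K.exists_le_finrank_eq (m := n - 1 - d) (by omega)
  have hinj : Set.InjOn (quotMap n) K' := by
    intro v hv w hw h
    rw [← sub_eq_zero]
    exact eq_zero_of_quotMap_eq_zero (by rw [map_sub, h, sub_self])
      (hK _ (hK' (K'.sub_mem hv hw)))
  have hU : Module.finrank ℝ (K'.map (quotMap n)) = n - 1 - d := by
    rw [← hfin', ← LinearMap.range_domRestrict]
    exact LinearMap.finrank_range_of_inj (Set.injOn_iff_injective.1 hinj)
  have hq := Submodule.finrank_quotient_add_finrank (K'.map (quotMap n))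
  have hQ := finrank_quotSpace hn
  have e : (QuotSpace n ⧸ K'.map (quotMap n)) ≃ₗ[ℝ] (Fin d → ℝ) :=
    LinearEquiv.ofFinrankEq _ _ (by
      rw [Module.finrank_fintype_fun_eq_card, Fintype.card_fin]
      omega)
  refine ⟨e.toLinearMap ∘ₗ Submodule.mkQ _,
    e.surjective.comp (Submodule.mkQ_surjective _), fun v hv => ?_⟩
  rw [mem_depSpace] at hv
  obtain ⟨hs, h0⟩ := hv
  have h1 : Submodule.mkQ (K'.map (quotMap n)) (quotMap n v) = 0 := e.map_eq_zero_iff.1 h0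
  rw [Submodule.mkQ_apply, Submodule.Quotient.mk_eq_zero] at h1
  obtain ⟨w, hw, hwv⟩ := h1
  have : v = w := by
    rw [← sub_eq_zero]
    refine eq_zero_of_quotMap_eq_zero (by rw [map_sub, hwv, sub_self]) ?_
    simp [Finset.sum_sub_distrib, hs, hK w (hK' hw)]
  exact this ▸ hK' hw

/-- The vectors orthogonal to the moment vectors `(0^s, 1^s, …, (n-1)^s)` for `s ≤ d`. -/
def momentKernel (n d : ℕ) : Submodule ℝ (Fin n → ℝ) :=
  (LinearMap.pi fun s : Fin (d + 1) =>
    ∑ j : Fin n, ((j : ℝ) ^ (s : ℕ)) • (LinearMap.proj j : (Fin n → ℝ) →ₗ[ℝ] ℝ)).ker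

theorem mem_momentKernel {v : Fin n → ℝ} :
    v ∈ momentKernel n d ↔ ∀ s ≤ d, ∑ j : Fin n, (j : ℝ) ^ s * v j = 0 := by
  rw [momentKernel, LinearMap.mem_ker]
  constructor
  · intro h s hs
    have := congrFun h ⟨s, Nat.lt_succ_of_le hs⟩
    simpa using this
  · intro h
    ext s
    simpa using h s (Nat.le_of_lt_succ s.2)

theorem le_finrank_momentKernel : n ≤ Module.finrank ℝ (momentKernel n d) + d + 1 := by
  have h := LinearMap.finrank_range_add_finrank_ker (LinearMap.pi fun s : Fin (d + 1) =>
    ∑ j : Fin n, ((j : ℝ) ^ (s : ℕ)) • (LinearMap.proj j : (Fin n → ℝ) →ₗ[ℝ] ℝ))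
  have h2 := Submodule.finrank_le (LinearMap.range (LinearMap.pi fun s : Fin (d + 1) =>
    ∑ j : Fin n, ((j : ℝ) ^ (s : ℕ)) • (LinearMap.proj j : (Fin n → ℝ) →ₗ[ℝ] ℝ)))
  rw [Module.finrank_fintype_fun_eq_card, Fintype.card_fin] at h h2
  change _ + Module.finrank ℝ (momentKernel n d) = n at h
  omega

theorem sum_mul_eval_eq_zero {v : Fin n → ℝ} (hv : v ∈ momentKernel n d) {f : Polynomial ℝ}
    (hf : f.natDegree ≤ d) : ∑ j : Fin n, f.eval (j : ℝ) * v j = 0 := by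
  rw [mem_momentKernel] at hv
  simp only [Polynomial.eval_eq_sum_range' (Nat.lt_succ_of_le hf), Finset.sum_mul]
  rw [Finset.sum_comm]
  refine Finset.sum_eq_zero fun s hs => ?_
  simp only [mul_assoc, ← Finset.mul_sum]
  rw [hv s (Nat.le_of_lt_succ (Finset.mem_range.1 hs)), mul_zero]

theorem sum_eq_zero_of_mem_momentKernel {v : Fin n → ℝ} (hv : v ∈ momentKernel n d) :
    ∑ j, v j = 0 := by
  simpa using mem_momentKernel.1 hv 0 (Nat.zero_le d)

/-- Cyclic polytope argument: the product of `(X - a) ^ 2` over the negative positions would have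
degree at most `d`, so it is orthogonal to `v`. All terms of that sum are nonnegative, and a
positive coordinate of `v` makes one of them strictly positive. -/
theorem lt_numNeg_of_mem_momentKernel {v : Fin n → ℝ} (hv : v ∈ momentKernel n d) (hv0 : v ≠ 0)
    {m : ℕ} (hm : 2 * m ≤ d) : m < numNeg v := by
  by_contra hle
  rw [not_lt] at hle
  set N : Finset (Fin n) := Finset.univ.filter fun j => v j < 0 with hN
  change N.card ≤ m at hle
  let f : Polynomial ℝ := ∏ a ∈ N, (Polynomial.X - Polynomial.C (a : ℝ)) ^ 2
  have hdeg : f.natDegree ≤ d := by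
    refine (Polynomial.natDegree_prod_le _ _).trans ?_
    refine (Finset.sum_le_card_nsmul N _ 2 fun a _ => ?_).trans ?_
    · refine Polynomial.natDegree_pow_le.trans ?_
      rw [Polynomial.natDegree_X_sub_C]
    · rw [smul_eq_mul]
      omega
  have heval : ∀ x : ℝ, f.eval x = ∏ a ∈ N, (x - (a : ℝ)) ^ 2 := fun x => by
    simp [f, Polynomial.eval_prod]
  have hnonneg : ∀ j ∈ Finset.univ, 0 ≤ f.eval ((j : Fin n) : ℝ) * v j := by
    intro j _
    rw [heval]
    by_cases hj : v j < 0
    · rw [Finset.prod_eq_zero (i := j) (by simp [hN, hj]) (by simp), zero_mul]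
    · exact mul_nonneg (Finset.prod_nonneg fun a _ => sq_nonneg _) (not_lt.1 hj)
  obtain ⟨a, ha⟩ := exists_pos_of_sum_eq_zero hv0 (sum_eq_zero_of_mem_momentKernel hv)
  have hz := (Finset.sum_eq_zero_iff_of_nonneg hnonneg).1 (sum_mul_eval_eq_zero hv hdeg) a
    (Finset.mem_univ a)
  rcases mul_eq_zero.1 hz with h | h
  · rw [heval, Finset.prod_eq_zero_iff] at h
    obtain ⟨b, hb, hab⟩ := h
    have hab' : (a : ℝ) = (b : ℝ) := by
      rw [sq_eq_zero_iff] at hab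
      linarith
    have : a = b := Fin.ext (by exact_mod_cast hab')
    rw [← this, hN, Finset.mem_filter] at hb
    linarith [hb.2]
  · exact ha.ne' h

/-- Some nonzero vector of `K` has its first `r - 1` coordinates zero. The hypothesis for it and its
negative gives at least `m + 1` coordinates of each sign among the rest. -/
theorem two_mul_le_of_forall_lt_numNeg {K : Submodule ℝ (Fin n → ℝ)} {m : ℕ}
    (hK : 0 < Module.finrank ℝ K) (h : ∀ v ∈ K, v ≠ 0 → m < numNeg v) :
    2 * m + 1 + Module.finrank ℝ K ≤ n := by
  classical
  set r := Module.finrank ℝ K with hr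
  have hrn : r ≤ n := by
    have := Submodule.finrank_le K
    rwa [Module.finrank_fintype_fun_eq_card, Fintype.card_fin] at this
  let g : K →ₗ[ℝ] (Fin (r - 1) → ℝ) :=
    LinearMap.pi fun s => LinearMap.proj (⟨s, by omega⟩ : Fin n) ∘ₗ K.subtype
  have hker : g.ker ≠ ⊥ := LinearMap.ker_ne_bot_of_finrank_lt (by
    rw [Module.finrank_fintype_fun_eq_card, Fintype.card_fin]
    omega)
  obtain ⟨⟨v, hv⟩, hvker, hv0⟩ := Submodule.exists_mem_ne_zero_of_ne_bot hker
  have hv0' : v ≠ 0 := fun h0 => hv0 (Subtype.ext h0)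
  have hvan : ∀ j : Fin n, (j : ℕ) < r - 1 → v j = 0 := fun j hj =>
    congrFun (LinearMap.mem_ker.1 hvker) ⟨j, hj⟩
  have h1 := h v hv hv0'
  have h2 := h (-v) (K.neg_mem hv) (neg_ne_zero.2 hv0')
  rw [numNeg_neg] at h2
  have hsub : numPos v + numNeg v + (r - 1) ≤ n := by
    have hd1 : Disjoint (Finset.univ.filter fun j => 0 < v j)
        (Finset.univ.filter fun j => v j < 0) := by
      rw [Finset.disjoint_left]
      intro j h1 h2
      simp only [Finset.mem_filter, Finset.mem_univ, true_and] at h1 h2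
      linarith
    have hd2 : Disjoint ((Finset.univ.filter fun j => 0 < v j) ∪
        (Finset.univ.filter fun j => v j < 0))
        (Finset.univ.map (Fin.castLEEmb (show r - 1 ≤ n by omega))) := by
      rw [Finset.disjoint_left]
      intro j h1 h2
      obtain ⟨s, -, rfl⟩ := Finset.mem_map.1 h2
      have := hvan (Fin.castLE (by omega) s) s.2
      simp only [Finset.mem_union, Finset.mem_filter, Finset.mem_univ, true_and,
        Fin.coe_castLEEmb, this, lt_irrefl, or_self] at h1
    have := Finset.card_le_univ (((Finset.univ.filter fun j => 0 < v j) ∪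
        (Finset.univ.filter fun j => v j < 0)) ∪
        (Finset.univ.map (Fin.castLEEmb (show r - 1 ≤ n by omega))))
    rw [Finset.card_union_of_disjoint hd2, Finset.card_union_of_disjoint hd1, Finset.card_map,
      Finset.card_univ, Fintype.card_fin, Fintype.card_fin] at this
    exact this
  omega

theorem exists_numPos_add_one_eq (hn : 2 ≤ n) :
    ∃ w : Fin n → ℝ, ∑ j, w j = 0 ∧ numPos w + 1 = n := by
  classical
  let a : Fin n := ⟨0, by omega⟩
  -- A single negative coordinate, `1 - n`, balances `n - 1` ones.
  refine ⟨(fun _ => 1) - Pi.single a (n : ℝ), by simp [Finset.sum_sub_distrib], ?_⟩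
  have : (Finset.univ.filter fun j =>
      0 < (((fun _ => 1) - Pi.single a (n : ℝ) : Fin n → ℝ) j)) =
      Finset.univ.erase a := by
    ext j
    rw [Finset.mem_filter, Finset.mem_erase]
    by_cases hj : j = a
    · subst hj
      have : n ≠ 0 := by omega
      simpa using this
    · simp [hj]
  rw [numPos, this, Finset.card_erase_of_mem (Finset.mem_univ a), Finset.card_univ,
    Fintype.card_fin]
  omega

theorem exists_isIPreserving_iff (hk : 1 ≤ k) (hkn : 2 * k ≤ n) (d : ℕ) :
    (∃ π : QuotSpace n →ₗ[ℝ] (Fin d → ℝ), Function.Surjective π ∧ IsIPreserving π k i) ↔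
      ((2 * k + 2 * i ≤ d ∧ d ≤ n - 1) ∨ (d = n - 2 ∧ i + 2 ≤ k) ∨ d = n - 1) := by
  have hn : 0 < n := by omega
  constructor
  · rintro ⟨π, hπ, h⟩
    have hd := finrank_depSpace hn hπ
    rw [isIPreserving_iff_neighborly hk hkn hπ, isNeighborly_iff hn,
      finrank_vectorSpan_range_pointConfig hn hπ, not_isAlmostNeighborly_iff hn hπ,
      bijective_iff_finrank_depSpace_eq_zero hn hπ] at h
    rcases h with h | ⟨h, v, hv, hp⟩ | h
    · rcases Nat.eq_zero_or_pos (Module.finrank ℝ (depSpace π)) with h0 | h0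
      · right; right; omega
      · have := two_mul_le_of_forall_lt_numNeg h0 h
        left
        omega
    · have hv0 : v ≠ 0 := by
        rintro rfl
        simp only [numPos, Pi.zero_apply, lt_irrefl, Finset.filter_false,
          Finset.card_empty] at hp
        omega
      -- A zero-sum vector has at most `n - 1` positive coordinates, which is where `i + 2 ≤ k`
      -- comes from.
      have h1 := numNeg_pos_of_sum_eq_zero hv0 (mem_depSpace.1 hv).1
      have h2 := numPos_add_numNeg_le v
      right; left
      omega
    · right; right; omega
  · rintro (⟨h1, h2⟩ | ⟨rfl, h⟩ | rfl)
    · obtain ⟨π, hπ, hle⟩ := exists_surjective_depSpace_le (d := d) (by omega) (momentKernel n d)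
        (fun v hv => sum_eq_zero_of_mem_momentKernel hv) le_finrank_momentKernel
      refine ⟨π, hπ, (isIPreserving_iff hk (by omega) π).2 fun v hv hv0 => Or.inl ?_⟩
      exact lt_numNeg_of_mem_momentKernel (hle hv) hv0 (by omega)
    · obtain ⟨w, hw, hwp⟩ := exists_numPos_add_one_eq (n := n) (by omega)
      have hw0 : w ≠ 0 := by
        rintro rfl
        simp only [numPos, Pi.zero_apply, lt_irrefl, Finset.filter_false,
          Finset.card_empty] at hwp
        omega
      obtain ⟨π, hπ, hle⟩ := exists_surjective_depSpace_le (d := n - 2) (by omega)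
        (Submodule.span ℝ {w}) (fun v hv => by
          obtain ⟨c, rfl⟩ := Submodule.mem_span_singleton.1 hv
          simp [← Finset.mul_sum, hw]) (by rw [finrank_span_singleton hw0]; omega)
      refine ⟨π, hπ, (isIPreserving_iff hk (by omega) π).2 fun v hv hv0 => ?_⟩
      exact lt_or_lt_of_mem_span_singleton hkn (by omega) (hle hv) hv0
    · obtain ⟨π, hπ, hle⟩ := exists_surjective_depSpace_le (n := n) (d := n - 1) (by omega) ⊥
        (fun v hv => by simp [(Submodule.mem_bot ℝ).1 hv]) (by omega)
      refine ⟨π, hπ, (isIPreserving_iff hk (by omega) π).2 fun v hv hv0 => ?_⟩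
      exact absurd ((Submodule.mem_bot ℝ).1 (hle hv)) hv0

end Existence

theorem theorem3 (n k i : ℕ) (hk : 1 ≤ k) (hkn : 2 * k ≤ n) (hi : i ≤ n - 1) :
    (∀ (d : ℕ) (π : QuotSpace n →ₗ[ℝ] (Fin d → ℝ)), Function.Surjective π →
      (IsIPreserving π k i ↔
        (IsNeighborly (pointConfig π) (k + i) ∨
          (Module.finrank ℝ (vectorSpan ℝ (Set.range (pointConfig π))) = n - 2 ∧
            ¬ IsAlmostNeighborly (pointConfig π) ((k : ℤ) - (i : ℤ) - 1)) ∨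
          Function.Bijective π))) ∧
    (∀ d : ℕ,
      (∃ π : QuotSpace n →ₗ[ℝ] (Fin d → ℝ), Function.Surjective π ∧ IsIPreserving π k i) ↔
        ((2 * k + 2 * i ≤ d ∧ d ≤ n - 1) ∨ (d = n - 2 ∧ i + 2 ≤ k) ∨ d = n - 1)) :=
  ⟨fun _ _ hπ => isIPreserving_iff_neighborly hk hkn hπ, exists_isIPreserving_iff hk hkn⟩
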